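/- **Model.** Let $\lambda>0$, $P_T>0$, $\beta>2$, $\sigma_n^2\ge 0$, $\phi\in[0,2\pi]$, $M_1>0$, $M_2\ge 0$, and put $c_1=\phi/(2\pi)$, $c_2=1-c_1$. The base stations (BSs) form a homogeneous Poisson point process $\Phi$ in $\mathbb R^2$ with density $\lambda$. The typical user is at the origin, and $R_l$ denotes its distance to the $l$-th nearest BS. The fading coefficients $\alpha_1,\alpha_2,\dots$ are independent, and each $|\alpha_l|^2$ is exponentially distributed with parameter $1$. The serving (nearest) BS has its main lobe aligned with the user, $D_1=M_1$; the directivity gains $D_2,D_3,\dots$ of the interfering BSs are independent and equal $M_1$ with probability $c_1$ and $M_2$ with probability $c_2$. The BS process, the fading and the gains are independent of each other. Let $$\mathcal I_{agg}=\sum_{l\ge 2}P_T R_l^{-\beta}|\alpha_l|^2D_l,\qquad \Upsilon=\frac{P_TR_1^{-\beta}|\alpha_1|^2D_1}{\mathcal I_{agg}+\sigma_n^2},\qquad P_c(\epsilon_2)=\mathbb P\{\Upsilon\ge\epsilon_2\}.$$ **Theorem 2.** The distance $R_1$ has the density $f_{R_1}(r_1)=2\pi\lambda r_1e^{-\pi\lambda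 r_1^2}$ on $(0,\infty)$. The aggregate interference $\mathcal I_{agg}$ is almost surely finite, and for every $s\ge0$ its conditional Laplace transform given $R_1=r_1$ is, for almost every $r_1$, $\mathbb E\big[e^{-s\mathcal I_{agg}}\mid R_1=r_1\big]=\mathcal L_{\mathcal I_{agg}}(s)$, where $$\mathcal L_{\mathcal I_{agg}}(s)=\exp\Big\{\pi\lambda r_1^2\Big(1-\sum_{t=1}^2\frac{c_t}{1+sP_TM_tr_1^{-\beta}}\Big)-\pi\lambda\, sP_Tr_1^2\sum_{t=1}^2c_tM_t\Big[\frac1{sP_TM_t+r_1^\beta}+\frac{2r_1^{-\beta}}{\beta-2}\,{}_2F_1\big(1,1-\tfrac2\beta;2-\tfrac2\beta;-sP_TM_tr_1^{-\beta}\big)\Big]\Big\}$$ and ${}_2F_1(a,b;c;z)$ is the Gauss hypergeometric function (analytically continued to $z<1$). For every threshold $\epsilon_2\ge0$, the coverage rate of the communication performance is $$P_c(\epsilon_2)=\int_0^\infty e^{-\frac{\epsilon_2\sigma_n^2}{P_Tr_1^{-\beta}M_1}}\;\mathcal L_{\mathcal I_{agg}}\Big(\frac{\epsilon_2}{P_Tr_1^{-\beta}M_1}\Big)f_{R_1}(r_1)\,\mathrm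 dr_1 ,$$ where the integrand is integrable. -/

import Mathlib

open MeasureTheory ProbabilityTheory
open scoped ENNReal

namespace CellularNetwork

/-- The Gauss hypergeometric function `₂F₁(a, b; c; z)` for real parameters `0 < b < c` and real
arguments `z < 1`, given by Euler's integral. This is the analytic continuation to `z < 1` of the
power series, see `gaussHypergeometric_eq_series`; Mathlib's `₂F₁` is the sum of that series, which
does not converge for `z < -1`. -/
noncomputable def gaussHypergeometric (a b c z : ℝ) : ℝ :=
  Real.Gamma c / (Real.Gamma b * Real.Gamma (c - b)) *
    ∫ t in Set.Ioo (0 : ℝ) 1, t ^ (b - 1) * (1 - t) ^ (c - b - 1) * (1 - z * t) ^ (-a)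

theorem euler_moment {u v : ℝ} (hu : 0 < u) (hv : 0 < v) :
    IntegrableOn (fun t : ℝ => t ^ (u - 1) * (1 - t) ^ (v - 1)) (Set.Ioo 0 1) ∧
    ∫ t in Set.Ioo (0 : ℝ) 1, t ^ (u - 1) * (1 - t) ^ (v - 1) =
      Real.Gamma u * Real.Gamma v / Real.Gamma (u + v) := by
  have h1 := Complex.betaIntegral_convergent (u := u) (v := v) (by simpa) (by simpa)
  rw [intervalIntegrable_iff_integrableOn_Ioo_of_le zero_le_one] at h1
  have hcongr : Set.EqOn (fun t : ℝ => (t : ℂ) ^ ((u : ℂ) - 1) * (1 - (t : ℂ)) ^ ((v : ℂ) - 1))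
      (fun t : ℝ => ((t ^ (u - 1) * (1 - t) ^ (v - 1) : ℝ) : ℂ)) (Set.Ioo 0 1) := by
    intro t ht
    have h0 : 0 ≤ t := ht.1.le
    have h2 : 0 ≤ 1 - t := by linarith [ht.2]
    simp only
    push_cast [Complex.ofReal_cpow h0, Complex.ofReal_cpow h2]
    rfl
  have h3 := h1.congr_fun hcongr measurableSet_Ioo
  refine ⟨?_, ?_⟩
  · have h4 := h3.re
    simp only [RCLike.re_to_complex, Complex.ofReal_re] at h4
    exact h4
  · rw [show Real.Gamma u * Real.Gamma v / Real.Gamma (u + v) = beta u v from rfl,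
      beta_eq_betaIntegralReal u v hu hv, Complex.betaIntegral,
      intervalIntegral.integral_of_le zero_le_one, integral_Ioc_eq_integral_Ioo,
      setIntegral_congr_fun measurableSet_Ioo hcongr, integral_complex_ofReal]
    simp

theorem ascPochhammer_eq_gamma {x : ℝ} (hx : 0 < x) (n : ℕ) :
    (ascPochhammer ℝ n).eval x = Real.Gamma (x + n) / Real.Gamma x := by
  induction n with
  | zero => simp [(Real.Gamma_pos_of_pos hx).ne']
  | succ n ih =>
    have h : (0 : ℝ) < x + n := by positivity
    rw [ascPochhammer_succ_right]
    simp only [Polynomial.eval_mul, ih, Polynomial.eval_add, Polynomial.eval_X,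
      Polynomial.eval_natCast]
    push_cast
    rw [← add_assoc, Real.Gamma_add_one h.ne']
    ring

theorem binomial_hasSum (a : ℝ) {x : ℝ} (hx : |x| < 1) :
    HasSum (fun n : ℕ => ((n.factorial : ℝ)⁻¹ * (ascPochhammer ℝ n).eval a) * x ^ n)
      ((1 - x) ^ (-a)) := by
  have hx' : -x ∈ Metric.eball (0 : ℝ) 1 := by
    rw [← ENNReal.ofReal_one, Metric.eball_ofReal]
    simpa using hx
  have h := (Real.one_add_rpow_hasFPowerSeriesOnBall_zero (a := -a)).hasSum hx'
  rw [binomialSeries_eq_ordinaryHypergeometricSeries (b := (1 : ℝ))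
    (by intro k; have : (0:ℝ) ≤ k := k.cast_nonneg; linarith)] at h
  have e1 (n : ℕ) : (n.factorial : ℝ)⁻¹ * (ascPochhammer ℝ n).eval a * x ^ n =
      (ordinaryHypergeometricSeries ℝ (- -a) 1 1).compContinuousLinearMap
        (-ContinuousLinearMap.id ℝ ℝ) n (fun _ => -x) := by
    have : (ascPochhammer ℝ n).eval 1 ≠ 0 := (ascPochhammer_pos n 1 one_pos).ne'
    have e : (⇑(-ContinuousLinearMap.id ℝ ℝ) ∘ fun _ : Fin n => -x) = fun _ => x := by
      ext; simp
    rw [FormalMultilinearSeries.compContinuousLinearMap_apply, e,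
      ordinaryHypergeometricSeries_apply_eq, neg_neg, smul_eq_mul,
      mul_inv_cancel_right₀ this]
  have e2 : (1 - x) ^ (-a) = (1 + (0 + -x)) ^ (-a) := by rw [zero_add, sub_eq_add_neg]
  rw [funext e1, e2]
  exact h

/-- On `|z| < 1` the function `gaussHypergeometric` is the sum of the hypergeometric series. -/
theorem gaussHypergeometric_eq_series {a b c z : ℝ} (hb : 0 < b) (hbc : b < c) (hz : |z| < 1) :
    gaussHypergeometric a b c z = ₂F₁ a b c z := by
  have hv : 0 < c - b := sub_pos.2 hbc
  set w : ℝ → ℝ := fun t => t ^ (b - 1) * (1 - t) ^ (c - b - 1) with hw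
  set q : ℕ → ℝ := fun n => (n.factorial : ℝ)⁻¹ * (ascPochhammer ℝ n).eval a with hq
  have hwi : IntegrableOn w (Set.Ioo 0 1) := (euler_moment hb hv).1
  have hmom (n : ℕ) : IntegrableOn (fun t => w t * t ^ n) (Set.Ioo 0 1) ∧
      ∫ t in Set.Ioo (0 : ℝ) 1, w t * t ^ n =
        Real.Gamma (b + n) * Real.Gamma (c - b) / Real.Gamma (c + n) := by
    have h := euler_moment (u := b + n) (v := c - b) (by positivity) hv
    have e : Set.EqOn (fun t : ℝ => t ^ (b + n - 1) * (1 - t) ^ (c - b - 1))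
        (fun t => w t * t ^ n) (Set.Ioo 0 1) := by
      intro t ht
      simp only [hw]
      rw [show b + n - 1 = (b - 1) + n by ring, Real.rpow_add_natCast ht.1.ne']
      ring
    rw [show c + (n : ℝ) = b + n + (c - b) by ring, ← setIntegral_congr_fun measurableSet_Ioo e]
    exact ⟨h.1.congr_fun e measurableSet_Ioo, h.2⟩
  have hsum := hasSum_integral_of_summable_integral_norm
    (μ := volume.restrict (Set.Ioo (0 : ℝ) 1))
    (F := fun n t => (q n * z ^ n) * (w t * t ^ n))
    (fun n => (hmom n).1.const_mul _) ?_
  · have e : ∫ t in Set.Ioo (0 : ℝ) 1, ∑' n, (q n * z ^ n) * (w t * t ^ n) =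
        ∫ t in Set.Ioo (0 : ℝ) 1, w t * (1 - z * t) ^ (-a) := by
      refine setIntegral_congr_fun measurableSet_Ioo fun t ht => ?_
      have hzt : |z * t| < 1 := by
        rw [abs_mul, abs_of_pos ht.1]
        nlinarith [abs_nonneg z, ht.1, ht.2]
      have := ((binomial_hasSum a hzt).mul_left (w t)).tsum_eq
      rw [← this]
      refine tsum_congr fun n => ?_
      simp only [hq, mul_pow]
      ring
    rw [e] at hsum
    rw [gaussHypergeometric, ordinaryHypergeometric_eq_tsum, ← hsum.tsum_eq, ← tsum_mul_left]
    refine tsum_congr fun n => ?_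
    rw [integral_const_mul, (hmom n).2, ascPochhammer_eq_gamma hb, ascPochhammer_eq_gamma (hb.trans hbc)]
    have := (Real.Gamma_pos_of_pos hb).ne'
    have := (Real.Gamma_pos_of_pos hv).ne'
    have := (Real.Gamma_pos_of_pos (hb.trans hbc)).ne'
    have : Real.Gamma (c + n) ≠ 0 := (Real.Gamma_pos_of_pos (by linarith [n.cast_nonneg (α := ℝ)])).ne'
    simp only [hq, smul_eq_mul]
    field_simp
  · have hs : Summable fun n => |q n * z ^ n| * ∫ t in Set.Ioo (0 : ℝ) 1, w t :=
      (binomial_hasSum a hz).summable.abs.mul_right _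
    refine Summable.of_nonneg_of_le (fun n => integral_nonneg fun _ => norm_nonneg _)
      (fun n => ?_) hs
    rw [← integral_const_mul]
    refine setIntegral_mono_on ((hmom n).1.const_mul _).norm (hwi.const_mul _) measurableSet_Ioo
      fun t ht => ?_
    have h0 : 0 ≤ w t := mul_nonneg (Real.rpow_nonneg ht.1.le _)
      (Real.rpow_nonneg (by linarith [ht.2]) _)
    rw [norm_mul, Real.norm_eq_abs, Real.norm_eq_abs,
      abs_of_nonneg (mul_nonneg h0 (pow_nonneg ht.1.le n))]
    refine mul_le_mul_of_nonneg_left ?_ (abs_nonneg _)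
    exact mul_le_of_le_one_right h0 (pow_le_one₀ ht.1.le ht.2.le)

/-- The plane, with the Euclidean distance and Lebesgue measure. -/
abbrev Plane : Type := EuclideanSpace ℝ (Fin 2)

/-- `Φ` is a homogeneous Poisson point process in the plane with intensity `lam` (a random set of
points): the number of points in a Borel set `B` is a random variable, it is Poisson with mean
`lam * area B` if `B` has finite area, and the numbers of points in disjoint Borel sets are
independent. -/
structure IsHomogeneousPPP {Ω : Type*} [MeasurableSpace Ω] (μ : Measure Ω) (lam : ℝ)
    (Φ : Ω → Set Plane) : Prop where
  measurable_count : ∀ B : Set Plane, MeasurableSet B → Measurable fun ω => (Φ ω ∩ B).encard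
  count_law : ∀ B : Set Plane, MeasurableSet B → volume B ≠ ∞ → ∀ k : ℕ,
    μ {ω | (Φ ω ∩ B).encard = k} = ENNReal.ofReal
      (Real.exp (-(lam * (volume B).toReal)) * (lam * (volume B).toReal) ^ k / k.factorial)
  count_indep : ∀ (n : ℕ) (B : Fin n → Set Plane), (∀ i, MeasurableSet (B i)) →
    Pairwise (fun i j => Disjoint (B i) (B j)) →
    iIndepFun (fun (i : Fin n) (ω : Ω) => (Φ ω ∩ B i).encard) μ

/-- The σ-algebra generated by a random set of points: the one generated by all its counts. -/
@[reducible]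
noncomputable def pointSigma {Ω : Type*} (Φ : Ω → Set Plane) : MeasurableSpace Ω :=
  ⨆ (B : Set Plane) (_ : MeasurableSet B),
    MeasurableSpace.comap (fun ω => (Φ ω ∩ B).encard) inferInstance

/-- The σ-algebra generated by a sequence of random variables. -/
@[reducible]
def seqSigma {Ω E : Type*} [MeasurableSpace E] (X : ℕ → Ω → E) : MeasurableSpace Ω :=
  ⨆ l : ℕ, MeasurableSpace.comap (X l) inferInstance

/-- The distance from the origin (the typical user) to the `(l + 1)`-st nearest point of `S`.
Index `0` is the nearest base station. -/
noncomputable def nearestDist (S : Set Plane) (l : ℕ) : ℝ :=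
  sInf {r : ℝ | 0 ≤ r ∧ (l : ℕ∞) + 1 ≤ (S ∩ Metric.closedBall 0 r).encard}

/-- Power received from the `(l + 1)`-st nearest base station: transmit power `P`, path loss
`r ^ (-β)`, fading power `|α|²`, directivity gain `D`. -/
noncomputable def rxPower (P β : ℝ) (S : Set Plane) (α : ℕ → ℂ) (D : ℕ → ℝ) (l : ℕ) : ℝ≥0∞ :=
  ENNReal.ofReal (P * nearestDist S l ^ (-β) * ‖α l‖ ^ 2 * D l)

/-- Aggregate interference: total power received from all but the nearest base station. -/
noncomputable def aggInterference (P β : ℝ) (S : Set Plane) (α : ℕ → ℂ) (D : ℕ → ℝ) : ℝ≥0∞ :=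
  ∑' k : ℕ, rxPower P β S α D (k + 1)

/-- Signal-to-interference-plus-noise ratio of the typical user with noise power `σ ^ 2`. -/
noncomputable def sinr (P β σ : ℝ) (S : Set Plane) (α : ℕ → ℂ) (D : ℕ → ℝ) : ℝ≥0∞ :=
  rxPower P β S α D 0 / (aggInterference P β S α D + ENNReal.ofReal (σ ^ 2))

/-- Probabilities of the main lobe (index `0`) and the side lobe (index `1`) for a main-lobe
width `φ`. -/
noncomputable def lobeProb (φ : ℝ) : Fin 2 → ℝ :=
  ![φ / (2 * Real.pi), 1 - φ / (2 * Real.pi)]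

/-- Law of the directivity gain of an interfering base station: `M t` with probability
`lobeProb φ t`. -/
noncomputable def gainLaw (φ : ℝ) (M : Fin 2 → ℝ) : Measure ℝ :=
  ∑ t : Fin 2, ENNReal.ofReal (lobeProb φ t) • Measure.dirac (M t)

/-- Density of the distance to the nearest base station. -/
noncomputable def nearestPDF (lam r : ℝ) : ℝ :=
  2 * Real.pi * lam * r * Real.exp (-(Real.pi * lam * r ^ 2))

/-- Closed form of the Laplace transform at `s` of the aggregate interference, given that the
nearest base station is at distance `r`. -/
noncomputable def interferenceLaplace (lam P β φ : ℝ) (M : Fin 2 → ℝ) (r s : ℝ) : ℝ :=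
  Real.exp
    (Real.pi * lam * r ^ 2 * (1 - ∑ t : Fin 2, lobeProb φ t / (1 + s * P * M t * r ^ (-β)))
      - Real.pi * lam * (s * P * r ^ 2) *
        ∑ t : Fin 2, lobeProb φ t * M t *
          (1 / (s * P * M t + r ^ β)
            + 2 * r ^ (-β) / (β - 2) *
              gaussHypergeometric 1 (1 - 2 / β) (2 - 2 / β) (-(s * P * M t * r ^ (-β)))))

end CellularNetwork

/-! Fix `s ≥ 0` and let A(r) = ∑ c_t / (1 + s P M_t r^(-β)). Averaging first over the exponential
fading and then over the two-valued gain, an interferer at distance r contributes the factor A(r) to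
the Laplace transform. So, given the stations, E e^(-sI) is the product of A(R_l) over all stations
but the nearest.

The remaining average over the Poisson process must keep track of R₁, and this is done without
conditioning on it. The Laplace functional E exp(-∑ f(p)) = exp(-λ ∫ (1 - e^(-f)))
(`IsHomogeneousPPP.lintegral_expNeg`) is applied to the radial cost that is infinite on the disc of
radius x and equals -log A outside. Infinite cost encodes the event R₁ > x, so E[1{R₁ > x} ∏
A(R_l)], with the nearest station included, equals exp(-πλx² - E(x)), where E(x) = 2πλ ∫_x^∞ r (1 -
A(r)) dr. Minus the derivative of this tail is A(x) · 2πλx e^(-πλx²) · e^(-E(x)). Dividing by A(R₁)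
removes the nearest station and leaves the density of R₁ times e^(-E(R₁))
(`lintegral_mul_expNeg_tsum_succ`). This identity contains both the density (`s = 0`) and the
conditional Laplace transform.

The published formula is e^(-E): two groups of its terms cancel, and the tail integral becomes
Euler's integral for ₂F₁ after a power substitution (`interferenceLaplace_eq`).

For coverage, the SINR exceeds ε exactly when the serving fading power exceeds c(R₁)(I + σ²), with
c(r) = ε / (P r^(-β) M₁). That power is a standard exponential independent of everything else, so
the probability is E e^(-c(R₁)(I + σ²)). The Laplace argument now depends on R₁; the fixed-`s`
identity extends to countably valued arguments by splitting, and then to measurable ones by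
dominated convergence (`IsDownlinkModel.lintegral_mul_expNeg`). The limit uses that I is almost
surely finite, which itself follows by letting `s` tend to 0. -/

namespace CellularNetwork

/-! ### The exponential of minus an extended nonnegative real. -/

/-- The function `x ↦ exp (-x)` on the extended nonnegative reals. -/
noncomputable def expNeg (x : ℝ≥0∞) : ℝ≥0∞ := (EReal.exp x)⁻¹

theorem expNeg_zero : expNeg 0 = 1 := by simp [expNeg]

/-- This value lets an infinite cost encode a forbidden event, so that void probabilities become
instances of Laplace functionals. -/
theorem expNeg_top : expNeg ∞ = 0 := by simp [expNeg]

theorem expNeg_add (x y : ℝ≥0∞) : expNeg (x + y) = expNeg x * expNeg y := by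
  have h (z : ℝ≥0∞) : EReal.exp z ≠ 0 := by simp
  rw [expNeg, EReal.coe_ennreal_add, EReal.exp_add, ENNReal.mul_inv (Or.inl (h x)) (Or.inr (h y))]
  rfl

theorem expNeg_antitone : Antitone expNeg := fun _ _ hxy =>
  ENNReal.inv_le_inv.2 (EReal.exp_monotone (EReal.coe_ennreal_le_coe_ennreal_iff.2 hxy))

theorem expNeg_le_one (x : ℝ≥0∞) : expNeg x ≤ 1 :=
  expNeg_zero ▸ expNeg_antitone (zero_le (a := x))

theorem expNeg_ne_top (x : ℝ≥0∞) : expNeg x ≠ ∞ := ((expNeg_le_one x).trans_lt (by simp)).ne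

theorem continuous_expNeg : Continuous expNeg :=
  continuous_inv.comp (ENNReal.continuous_exp.comp continuous_coe_ennreal_ereal)

theorem measurable_expNeg : Measurable expNeg := continuous_expNeg.measurable

theorem expNeg_ofReal {x : ℝ} (hx : 0 ≤ x) :
    expNeg (ENNReal.ofReal x) = ENNReal.ofReal (Real.exp (-x)) := by
  rw [expNeg, EReal.coe_ennreal_ofReal, max_eq_left hx, EReal.exp_coe, Real.exp_neg,
    ENNReal.ofReal_inv_of_pos (Real.exp_pos x)]

theorem expNeg_eq_ofReal {x : ℝ≥0∞} (hx : x ≠ ∞) :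
    expNeg x = ENNReal.ofReal (Real.exp (-x.toReal)) := by
  rw [← expNeg_ofReal ENNReal.toReal_nonneg, ENNReal.ofReal_toReal hx]

theorem expNeg_eq_zero {x : ℝ≥0∞} : expNeg x = 0 ↔ x = ∞ := by
  simp [expNeg]

theorem expNeg_sum {ι : Type*} (s : Finset ι) (f : ι → ℝ≥0∞) :
    expNeg (∑ i ∈ s, f i) = ∏ i ∈ s, expNeg (f i) := by
  classical
  induction s using Finset.induction_on with
  | empty => simp [expNeg_zero]
  | insert i s hi ih => rw [Finset.sum_insert hi, Finset.prod_insert hi, expNeg_add, ih]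

theorem tendsto_expNeg_tsum (f : ℕ → ℝ≥0∞) :
    Filter.Tendsto (fun n => ∏ i ∈ Finset.range n, expNeg (f i)) Filter.atTop
      (nhds (expNeg (∑' i, f i))) := by
  simp_rw [← expNeg_sum]
  exact (continuous_expNeg.tendsto _).comp (ENNReal.tendsto_nat_tsum f)

/-! ### Ordered distances of a locally finite configuration. -/

/-- A locally finite, infinite set of points that does not contain the origin. -/
structure IsRegularConfig (S : Set Plane) : Prop where
  finite_inter : ∀ n : ℕ, (S ∩ Metric.closedBall 0 n).Finite
  infinite : S.Infinite
  zero_notMem : (0 : Plane) ∉ S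

namespace IsRegularConfig

variable {S : Set Plane}

theorem finite_inter_closedBall (hS : IsRegularConfig S) (r : ℝ) :
    (S ∩ Metric.closedBall 0 r).Finite := by
  obtain ⟨n, hn⟩ := exists_nat_ge r
  exact (hS.finite_inter n).subset
    (Set.inter_subset_inter_right _ (Metric.closedBall_subset_closedBall hn))

theorem countable (hS : IsRegularConfig S) : S.Countable := by
  have : S = ⋃ n : ℕ, S ∩ Metric.closedBall 0 n := by
    rw [← Set.inter_iUnion, Metric.iUnion_closedBall_nat, Set.inter_univ]
  rw [this]
  exact Set.countable_iUnion fun n => (hS.finite_inter n).countable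

theorem exists_le_encard (hS : IsRegularConfig S) (l : ℕ) :
    ∃ r : ℝ, 0 ≤ r ∧ (l : ℕ∞) + 1 ≤ (S ∩ Metric.closedBall 0 r).encard := by
  obtain ⟨t, hts, htc⟩ := hS.infinite.exists_subset_card_eq (l + 1)
  obtain ⟨r, hr⟩ := (t.finite_toSet.isBounded).subset_closedBall (0 : Plane)
  refine ⟨max r 0, le_max_right _ _, ?_⟩
  have h : (t : Set Plane) ⊆ S ∩ Metric.closedBall 0 (max r 0) :=
    Set.subset_inter hts (hr.trans (Metric.closedBall_subset_closedBall (le_max_left _ _)))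
  have h2 := Set.encard_le_encard h
  rw [Set.encard_coe_eq_coe_finsetCard, htc] at h2
  exact_mod_cast h2

/-- Local finiteness leaves a gap just beyond radius `r` that contains no point, so the infimum
defining the distance is attained on closed balls. -/
theorem nearestDist_le_iff (hS : IsRegularConfig S) (l : ℕ) {r : ℝ} (hr : 0 ≤ r) :
    nearestDist S l ≤ r ↔ (l : ℕ∞) + 1 ≤ (S ∩ Metric.closedBall 0 r).encard := by
  have hbdd : BddBelow {r : ℝ | 0 ≤ r ∧ (l : ℕ∞) + 1 ≤ (S ∩ Metric.closedBall 0 r).encard} :=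
    ⟨0, fun _ h => h.1⟩
  refine ⟨fun h => ?_, fun h => csInf_le hbdd ⟨hr, h⟩⟩
  have hfin : ((S ∩ Metric.closedBall 0 (r + 1)) \ Metric.closedBall 0 r).Finite :=
    (hS.finite_inter_closedBall (r + 1)).sdiff
  have hev : ∀ᶠ r' in nhdsWithin r (Set.Ioi r),
      ∀ p ∈ ((S ∩ Metric.closedBall 0 (r + 1)) \ Metric.closedBall 0 r), r' < ‖p‖ := by
    refine hfin.eventually_all.2 fun p hp => ?_
    have : r < ‖p‖ := by simpa using hp.2
    exact nhdsWithin_le_nhds (Iio_mem_nhds this)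
  have hev2 : ∀ᶠ r' in nhdsWithin r (Set.Ioi r), r' < r + 1 :=
    nhdsWithin_le_nhds (Iio_mem_nhds (by linarith))
  obtain ⟨r', h1, h2, h3⟩ := (hev.and (hev2.and self_mem_nhdsWithin)).exists
  have h3 : r < r' := h3
  obtain ⟨x, ⟨hx0, hx⟩, hxr⟩ := exists_lt_of_csInf_lt (hS.exists_le_encard l) (h.trans_lt h3)
  refine hx.trans (Set.encard_le_encard fun p hp => ⟨hp.1, ?_⟩)
  have hp2 : ‖p‖ ≤ x := by simpa using hp.2
  by_contra hpr
  have := h1 p ⟨⟨hp.1, by simp; linarith⟩, hpr⟩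
  linarith

theorem nearestDist_pos (hS : IsRegularConfig S) (l : ℕ) : 0 < nearestDist S l := by
  by_contra! h
  rw [hS.nearestDist_le_iff l le_rfl] at h
  have : S ∩ Metric.closedBall 0 0 = ∅ := by
    simpa using hS.zero_notMem
  rw [this] at h
  simp at h

theorem nearestDist_mono (hS : IsRegularConfig S) : Monotone (nearestDist S) := by
  intro k l hkl
  rw [hS.nearestDist_le_iff k (hS.nearestDist_pos l).le]
  refine le_trans ?_ ((hS.nearestDist_le_iff l (hS.nearestDist_pos l).le).1 le_rfl)
  gcongr

/-- On each half-line up to `b` both measures count the points in the closed ball of radius `b`, a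
finite number. Ties at equal distance are counted with multiplicity on both sides, so no labelling
of the points by rank is needed. -/
theorem sum_dirac_nearestDist (hS : IsRegularConfig S) :
    Measure.sum (fun l => Measure.dirac (nearestDist S l)) =
      (Measure.count.restrict S).map (fun p : Plane => ‖p‖) := by
  set m₁ : Measure ℝ := Measure.sum (fun l => Measure.dirac (nearestDist S l)) with hm₁
  set m₂ : Measure ℝ := (Measure.count.restrict S).map (fun p : Plane => ‖p‖) with hm₂
  have e₁ (b : ℝ) : m₁ (Set.Iic b) = ((S ∩ Metric.closedBall 0 b).encard : ℝ≥0∞) := by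
    rw [hm₁, Measure.sum_apply _ measurableSet_Iic]
    simp_rw [Measure.dirac_apply' _ measurableSet_Iic]
    rcases lt_or_ge b 0 with hb | hb
    · rw [Metric.closedBall_eq_empty.2 hb]
      simp [Set.indicator, fun l => (hb.trans (hS.nearestDist_pos l)).not_ge]
    · obtain ⟨n, hn⟩ := ENat.ne_top_iff_exists.1 (hS.finite_inter_closedBall b).encard_lt_top.ne
      have h (l : ℕ) : nearestDist S l ≤ b ↔ l ∈ Finset.range n := by
        rw [hS.nearestDist_le_iff l hb, ← hn, Finset.mem_range]
        norm_cast
      simp only [Set.indicator, Set.mem_Iic, h, Pi.one_apply]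
      rw [tsum_eq_sum (s := Finset.range n) (by simp +contextual), ← hn]
      simp +contextual
  have e₂ (b : ℝ) : m₂ (Set.Iic b) = ((S ∩ Metric.closedBall 0 b).encard : ℝ≥0∞) := by
    have hpre : (fun p : Plane => ‖p‖) ⁻¹' Set.Iic b = Metric.closedBall 0 b := by
      ext p; simp
    rw [hm₂, Measure.map_apply measurable_norm measurableSet_Iic, hpre,
      Measure.restrict_apply Metric.isClosed_closedBall.measurableSet, Set.inter_comm,
      Measure.count_apply (hS.countable.mono Set.inter_subset_left).measurableSet]
  have hfin (b : ℝ) : ((S ∩ Metric.closedBall 0 b).encard : ℝ≥0∞) ≠ ∞ := by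
    simpa using hS.finite_inter_closedBall b
  have e₃ (m : Measure ℝ) (hm : ∀ b, m (Set.Iic b) = ((S ∩ Metric.closedBall 0 b).encard : ℝ≥0∞))
      (a b : ℝ) (hab : a < b) : m (Set.Ioc a b) =
        ((S ∩ Metric.closedBall 0 b).encard : ℝ≥0∞) - (S ∩ Metric.closedBall 0 a).encard := by
    rw [← Set.Iic_sdiff_Iic, measure_sdiff (Set.Iic_subset_Iic.2 hab.le)
      measurableSet_Iic.nullMeasurableSet (by rw [hm]; exact hfin a), hm, hm]
  refine Measure.ext_of_Ioc' _ _ (fun a b hab => ?_) fun a b hab => ?_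
  · exact ((measure_mono Set.Ioc_subset_Iic_self).trans_lt
      (by rw [e₁]; exact (hfin b).lt_top)).ne
  · rw [e₃ m₁ e₁ a b hab, e₃ m₂ e₂ a b hab]

/-- Turns a shot noise over ranked distances into an integral over the point set, the form to which
the Laplace functional applies. -/
theorem tsum_nearestDist (hS : IsRegularConfig S) {f : ℝ → ℝ≥0∞} (hf : Measurable f) :
    ∑' l, f (nearestDist S l) = ∫⁻ p, f ‖p‖ ∂(Measure.count.restrict S) := by
  rw [← lintegral_map hf measurable_norm, ← hS.sum_dirac_nearestDist, lintegral_sum_measure]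
  simp [lintegral_dirac' _ hf]

end IsRegularConfig

/-- The admissible radii form an upward closed set, so rational radii detect whether the infimum is
below a level. The σ-algebra is arbitrary because the lemma is also used for the one generated by
the counts. -/
theorem measurable_nearestDist {Ω : Type*} [MeasurableSpace Ω] {Φ : Ω → Set Plane}
    (h : ∀ B : Set Plane, MeasurableSet B → Measurable fun ω => (Φ ω ∩ B).encard) (l : ℕ) :
    Measurable fun ω => nearestDist (Φ ω) l := by
  refine measurable_of_Iio fun t => ?_
  set A : Ω → Set ℝ :=
    fun ω => {r : ℝ | 0 ≤ r ∧ (l : ℕ∞) + 1 ≤ (Φ ω ∩ Metric.closedBall 0 r).encard} with hA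
  have hmono (ω : Ω) {r r' : ℝ} (hr : r ∈ A ω) (hrr : r ≤ r') : r' ∈ A ω :=
    ⟨hr.1.trans hrr, hr.2.trans (Set.encard_le_encard
      (Set.inter_subset_inter_right _ (Metric.closedBall_subset_closedBall hrr)))⟩
  have hmeas (r : ℝ) : MeasurableSet {ω | r ∈ A ω} := by
    by_cases hr : 0 ≤ r
    · simp only [hA, Set.mem_ofPred_eq, hr, true_and]
      exact h _ Metric.isClosed_closedBall.measurableSet (MeasurableSet.of_discrete (s := Set.Ici ((l : ℕ∞) + 1)))
    · simp [hA, hr]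
  have hne : MeasurableSet {ω | (A ω).Nonempty} := by
    have : {ω | (A ω).Nonempty} = ⋃ n : ℕ, {ω | (n : ℝ) ∈ A ω} := by
      ext ω
      simp only [Set.mem_ofPred_eq, Set.mem_iUnion]
      refine ⟨fun ⟨r, hr⟩ => ?_, fun ⟨n, hn⟩ => ⟨_, hn⟩⟩
      obtain ⟨n, hn⟩ := exists_nat_ge r
      exact ⟨n, hmono ω hr hn⟩
    rw [this]
    exact MeasurableSet.iUnion fun n => hmeas n
  -- The second set collects the configurations with at most `l` points: there the infimum is over
  -- the empty set and equals 0 by convention.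
  have : (fun ω => nearestDist (Φ ω) l) ⁻¹' Set.Iio t =
      (⋃ q : ℚ, {ω | (q : ℝ) < t ∧ (q : ℝ) ∈ A ω}) ∪ {ω | ¬ (A ω).Nonempty ∧ 0 < t} := by
    ext ω
    simp only [Set.mem_preimage, Set.mem_Iio, Set.mem_union, Set.mem_iUnion, Set.mem_ofPred_eq]
    change sInf (A ω) < t ↔ _
    by_cases hω : (A ω).Nonempty
    · simp only [hω, not_true_eq_false, false_and, or_false]
      rw [csInf_lt_iff ⟨0, fun _ h => h.1⟩ hω]
      constructor
      · rintro ⟨r, hr, hrt⟩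
        obtain ⟨q, hq, hqt⟩ := exists_rat_btwn hrt
        exact ⟨q, hqt, hmono ω hr hq.le⟩
      · rintro ⟨q, hq, hqt⟩
        exact ⟨q, hqt, hq⟩
    · have h0 : A ω = ∅ := Set.not_nonempty_iff_eq_empty.1 hω
      simp [h0, Real.sInf_empty]
  rw [this]
  refine (MeasurableSet.iUnion fun q => ?_).union ?_
  · by_cases hq : (q : ℝ) < t
    · simpa [hq] using hmeas q
    · simp [hq]
  · by_cases ht : 0 < t
    · simp only [ht, and_true]
      exact hne.compl
    · simp [ht]

/-! ### Laplace functional and regularity of the Poisson process. -/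

/-- The formula holds for arbitrary `S`: a finite intersection is automatically measurable, and an
infinite one has infinite counting measure in any case. -/
theorem count_restrict_apply (S : Set Plane) {B : Set Plane} (hB : MeasurableSet B) :
    Measure.count.restrict S B = ((S ∩ B).encard : ℝ≥0∞) := by
  rw [Measure.restrict_apply hB, Set.inter_comm]
  by_cases h : (S ∩ B).Finite
  · exact Measure.count_apply h.measurableSet
  · rw [Measure.count_apply_infinite h, Set.Infinite.encard_eq h]
    simp

theorem expNeg_mul_natCast (a : ℝ≥0∞) (k : ℕ) : expNeg (a * k) = expNeg a ^ k := by
  induction k with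
  | zero => simp [expNeg_zero]
  | succ k ih => rw [Nat.cast_succ, mul_add, mul_one, expNeg_add, ih, pow_succ]

/-- The fibre over 0 is dropped because it may have infinite volume, outside the scope of the
Poisson count law. -/
theorem _root_.MeasureTheory.SimpleFunc.lintegral_comp_eq_sum {E : Type*} [MeasurableSpace E]
    (f : SimpleFunc E ℝ≥0∞) (ν : Measure E) {g : ℝ≥0∞ → ℝ≥0∞} (hg : g 0 = 0) :
    ∫⁻ x, g (f x) ∂ν = ∑ a ∈ f.range.erase 0, g a * ν (f ⁻¹' {a}) := by
  have h : ∫⁻ x, g (f x) ∂ν = (f.map g).lintegral ν := by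
    rw [← SimpleFunc.lintegral_eq_lintegral]; rfl
  rw [h, SimpleFunc.map_lintegral]
  refine (Finset.sum_subset (Finset.erase_subset _ _) fun a ha ha' => ?_).symm
  have : a = 0 := by
    by_contra h0
    exact ha' (Finset.mem_erase.2 ⟨h0, ha⟩)
  simp [this, hg]

theorem hasSum_pow_div_factorial (x : ℝ) :
    HasSum (fun n : ℕ => x ^ n / n.factorial) (Real.exp x) := by
  rw [Real.exp_eq_exp_ℝ]
  exact NormedSpace.expSeries_div_hasSum_exp x

namespace IsHomogeneousPPP

variable {Ω : Type*} [MeasurableSpace Ω] {μ : Measure Ω} [IsProbabilityMeasure μ] {lam : ℝ}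
  {Φ : Ω → Set Plane}

/-- The Poisson masses of the finite values already sum to one, leaving none for the value `⊤`. -/
theorem ae_encard_lt_top (hΦ : IsHomogeneousPPP μ lam Φ) (hlam : 0 ≤ lam) {B : Set Plane}
    (hB : MeasurableSet B) (hv : volume B ≠ ∞) : ∀ᵐ ω ∂μ, (Φ ω ∩ B).encard ≠ ⊤ := by
  set m : ℝ := lam * (volume B).toReal with hm
  have hm0 : 0 ≤ m := mul_nonneg hlam ENNReal.toReal_nonneg
  have hmeas (k : ℕ) : MeasurableSet {ω | (Φ ω ∩ B).encard = k} :=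
    hΦ.measurable_count B hB (measurableSet_singleton (k : ℕ∞))
  have hU : {ω | (Φ ω ∩ B).encard ≠ ⊤} = ⋃ k : ℕ, {ω | (Φ ω ∩ B).encard = k} := by
    ext ω
    simp only [Set.mem_ofPred_eq, Set.mem_iUnion, ENat.ne_top_iff_exists]
    exact exists_congr fun _ => eq_comm
  have hs : HasSum (fun k : ℕ => Real.exp (-m) * m ^ k / k.factorial) 1 := by
    have := (hasSum_pow_div_factorial m).mul_left (Real.exp (-m))
    rw [← Real.exp_add, neg_add_cancel, Real.exp_zero] at this
    simpa only [mul_div_assoc] using this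
  have h1 : μ {ω | (Φ ω ∩ B).encard ≠ ⊤} = 1 := by
    rw [hU, measure_iUnion _ hmeas]
    · simp_rw [hΦ.count_law B hB hv]
      rw [← ENNReal.ofReal_tsum_of_nonneg (fun k => by positivity) hs.summable, hs.tsum_eq,
        ENNReal.ofReal_one]
    · intro i j hij
      refine Set.disjoint_left.2 fun ω h1 h2 => hij ?_
      have h1 : (Φ ω ∩ B).encard = i := h1
      have h2 : (Φ ω ∩ B).encard = j := h2
      exact_mod_cast h1.symm.trans h2
  have hm : MeasurableSet {ω | (Φ ω ∩ B).encard ≠ ⊤} :=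
    hΦ.measurable_count B hB (measurableSet_singleton (⊤ : ℕ∞)).compl
  exact (prob_compl_eq_zero_iff hm).2 h1

/-- This is the Poisson generating function E w^N = exp(-m (1 - w)) at w = e^(-a). The case `a = ∞`,
w = 0, is the void probability. -/
theorem lintegral_expNeg_encard (hΦ : IsHomogeneousPPP μ lam Φ) (hlam : 0 ≤ lam) {B : Set Plane}
    (hB : MeasurableSet B) (hv : volume B ≠ ∞) (a : ℝ≥0∞) :
    ∫⁻ ω, expNeg (a * ((Φ ω ∩ B).encard : ℝ≥0∞)) ∂μ =
      expNeg (ENNReal.ofReal lam * ((1 - expNeg a) * volume B)) := by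
  set v : ℝ := (volume B).toReal with hv'
  set w : ℝ := (expNeg a).toReal with hw
  have hw0 : 0 ≤ w := ENNReal.toReal_nonneg
  have hwa : expNeg a = ENNReal.ofReal w := (ENNReal.ofReal_toReal (expNeg_ne_top a)).symm
  have hw1 : w ≤ 1 := by
    have := ENNReal.toReal_mono (by simp) (expNeg_le_one a)
    simpa using this
  have hv0 : 0 ≤ v := ENNReal.toReal_nonneg
  have hae := hΦ.ae_encard_lt_top hlam hB hv
  set N : Ω → ℕ := fun ω => (Φ ω ∩ B).encard.toNat with hN
  have hNm : Measurable N := (measurable_of_countable ENat.toNat).comp (hΦ.measurable_count B hB)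
  have hNae : ∀ᵐ ω ∂μ, (Φ ω ∩ B).encard = N ω := by
    filter_upwards [hae] with ω hω using (ENat.natCast_toNat hω).symm
  have hlaw (k : ℕ) : μ.map N {k} =
      ENNReal.ofReal (Real.exp (-(lam * v)) * (lam * v) ^ k / k.factorial) := by
    rw [Measure.map_apply hNm (measurableSet_singleton k), ← hΦ.count_law B hB hv k]
    refine measure_congr ?_
    filter_upwards [hNae] with ω hω
    apply propext
    change N ω = k ↔ (Φ ω ∩ B).encard = k
    rw [hω]
    norm_cast
  calc ∫⁻ ω, expNeg (a * ((Φ ω ∩ B).encard : ℝ≥0∞)) ∂μ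
      = ∫⁻ ω, expNeg a ^ N ω ∂μ := by
        refine lintegral_congr_ae ?_
        filter_upwards [hNae] with ω hω
        rw [hω, ← expNeg_mul_natCast]
        simp
    _ = ∫⁻ k, expNeg a ^ k ∂(μ.map N) := (lintegral_map (measurable_of_countable _) hNm).symm
    _ = ∑' k : ℕ, ENNReal.ofReal (Real.exp (-(lam * v)) * ((lam * v * w) ^ k / k.factorial)) := by
        rw [lintegral_countable']
        refine tsum_congr fun k => ?_
        rw [hlaw, hwa, ← ENNReal.ofReal_pow hw0, ← ENNReal.ofReal_mul (by positivity)]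
        congr 1
        rw [mul_pow (lam * v)]
        ring
    _ = ENNReal.ofReal (Real.exp (-(lam * ((1 - w) * v)))) := by
        have hs := (hasSum_pow_div_factorial (lam * v * w)).mul_left (Real.exp (-(lam * v)))
        rw [← ENNReal.ofReal_tsum_of_nonneg (fun k => by positivity) hs.summable, hs.tsum_eq,
          ← Real.exp_add]
        congr 2
        ring
    _ = expNeg (ENNReal.ofReal lam * ((1 - expNeg a) * volume B)) := by
        have h1w : 0 ≤ 1 - w := by linarith
        rw [hwa, ← ENNReal.ofReal_one, ← ENNReal.ofReal_sub _ hw0, ← ENNReal.ofReal_toReal hv,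
          ← ENNReal.ofReal_mul h1w, ← ENNReal.ofReal_mul hlam, expNeg_ofReal (by positivity)]

/-- The fibres over distinct nonzero values are disjoint, hence their counts are independent Poisson
variables and the expectation factors into generating functions. -/
theorem lintegral_expNeg_simpleFunc (hΦ : IsHomogeneousPPP μ lam Φ) (hlam : 0 ≤ lam)
    (g : SimpleFunc Plane ℝ≥0∞) (hg : ∀ a ≠ 0, volume (g ⁻¹' {a}) ≠ ∞) :
    ∫⁻ ω, expNeg (∫⁻ p, g p ∂(Measure.count.restrict (Φ ω))) ∂μ =
      expNeg (ENNReal.ofReal lam * ∫⁻ p, (1 - expNeg (g p))) := by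
  set T := g.range.erase 0 with hT
  have hBm (a : ℝ≥0∞) : MeasurableSet (g ⁻¹' {a}) := g.measurableSet_fiber a
  let e : Fin T.card ≃ T := T.equivFin.symm
  have hcount (ω : Ω) : ∫⁻ p, g p ∂(Measure.count.restrict (Φ ω)) =
      ∑ a ∈ T, a * ((Φ ω ∩ g ⁻¹' {a}).encard : ℝ≥0∞) := by
    rw [SimpleFunc.lintegral_comp_eq_sum g _ (g := fun x => x) rfl]
    exact Finset.sum_congr rfl fun a _ => by rw [count_restrict_apply _ (hBm a)]
  have hvol : ∫⁻ p, (1 - expNeg (g p)) = ∑ a ∈ T, (1 - expNeg a) * volume (g ⁻¹' {a}) :=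
    SimpleFunc.lintegral_comp_eq_sum g _ (g := fun x => 1 - expNeg x) (by simp [expNeg_zero])
  have hind := hΦ.count_indep T.card (fun i => g ⁻¹' {(e i : ℝ≥0∞)}) (fun i => hBm _) (by
    intro i j hij
    refine Set.disjoint_left.2 fun p h1 h2 => hij (e.injective (Subtype.ext ?_))
    have h1 : g p = e i := h1
    have h2 : g p = e j := h2
    exact h1.symm.trans h2)
  have hind' := hind.comp (fun i (k : ℕ∞) => expNeg ((e i : ℝ≥0∞) * (k : ℝ≥0∞)))
    fun i => measurable_of_countable _
  have hprod := lintegral_prod_eq_prod_lintegral_of_indepFun Finset.univ _ hind' fun i =>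
    (measurable_of_countable _).comp (hΦ.measurable_count _ (hBm _))
  have hre (F : ℝ≥0∞ → ℝ≥0∞) : ∏ i : Fin T.card, F (e i) = ∏ a ∈ T, F a := by
    rw [e.prod_comp (fun a : T => F a), Finset.prod_coe_sort T F]
  simp_rw [hcount, expNeg_sum]
  calc ∫⁻ ω, ∏ a ∈ T, expNeg (a * ((Φ ω ∩ g ⁻¹' {a}).encard : ℝ≥0∞)) ∂μ
      = ∫⁻ ω, ∏ i : Fin T.card,
          expNeg ((e i : ℝ≥0∞) * ((Φ ω ∩ g ⁻¹' {(e i : ℝ≥0∞)}).encard : ℝ≥0∞)) ∂μ := by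
        refine lintegral_congr fun ω => ?_
        rw [hre fun a => expNeg (a * ((Φ ω ∩ g ⁻¹' {a}).encard : ℝ≥0∞))]
    _ = ∏ i : Fin T.card, ∫⁻ ω,
          expNeg ((e i : ℝ≥0∞) * ((Φ ω ∩ g ⁻¹' {(e i : ℝ≥0∞)}).encard : ℝ≥0∞)) ∂μ := hprod
    _ = ∏ a ∈ T, expNeg (ENNReal.ofReal lam * ((1 - expNeg a) * volume (g ⁻¹' {a}))) := by
        rw [hre fun a => ∫⁻ ω, expNeg (a * ((Φ ω ∩ g ⁻¹' {a}).encard : ℝ≥0∞)) ∂μ]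
        exact Finset.prod_congr rfl fun a ha =>
          hΦ.lintegral_expNeg_encard hlam (hBm a) (hg a (Finset.ne_of_mem_erase ha)) a
    _ = _ := by rw [hvol, Finset.mul_sum, expNeg_sum]

/-- The Laplace functional of a homogeneous Poisson point process. -/
theorem lintegral_expNeg (hΦ : IsHomogeneousPPP μ lam Φ) (hlam : 0 ≤ lam)
    {g : Plane → ℝ≥0∞} (hg : Measurable g) :
    ∫⁻ ω, expNeg (∫⁻ p, g p ∂(Measure.count.restrict (Φ ω))) ∂μ =
      expNeg (ENNReal.ofReal lam * ∫⁻ p, (1 - expNeg (g p))) := by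
  have hball (n : ℕ) : MeasurableSet (Metric.closedBall (0 : Plane) n) :=
    Metric.isClosed_closedBall.measurableSet
  -- Cutting off to the ball of radius `n` gives every fibre over a nonzero value finite volume,
  -- while keeping the approximation increasing.
  set G : ℕ → SimpleFunc Plane ℝ≥0∞ :=
    fun n => (SimpleFunc.eapprox g n).restrict (Metric.closedBall 0 n) with hG
  have hGapp (n : ℕ) (p : Plane) :
      G n p = (Metric.closedBall (0 : Plane) n).indicator (SimpleFunc.eapprox g n) p :=
    SimpleFunc.restrict_apply _ (hball n) p
  have hGmono : Monotone fun n p => G n p := by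
    intro m n hmn p
    simp only [hGapp]
    refine Set.indicator_le_indicator_of_subset
      (Metric.closedBall_subset_closedBall (Nat.cast_le.2 hmn)) (fun _ => zero_le) p |>.trans ?_
    exact Set.indicator_le_indicator (SimpleFunc.monotone_eapprox g hmn p)
  have hGtend (p : Plane) : Filter.Tendsto (fun n => G n p) Filter.atTop (nhds (g p)) := by
    have h1 : Filter.Tendsto (fun n => SimpleFunc.eapprox g n p) Filter.atTop (nhds (g p)) := by
      rw [← SimpleFunc.iSup_eapprox_apply hg p]
      exact tendsto_atTop_iSup fun m n hmn => SimpleFunc.monotone_eapprox g hmn p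
    refine h1.congr' ?_
    obtain ⟨n₀, hn₀⟩ := exists_nat_ge ‖p‖
    filter_upwards [Filter.eventually_ge_atTop n₀] with n hn
    rw [hGapp, Set.indicator_of_mem]
    have : (n₀ : ℝ) ≤ n := by exact_mod_cast hn
    simpa using hn₀.trans this
  have hGvol (n : ℕ) (a : ℝ≥0∞) (ha : a ≠ 0) : volume (G n ⁻¹' {a}) ≠ ∞ := by
    refine ((measure_mono (t := Metric.closedBall (0 : Plane) n) fun p hp => ?_).trans_lt
      measure_closedBall_lt_top).ne
    by_contra hpn
    refine ha ?_
    have : G n p = a := hp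
    rw [← this, hGapp, Set.indicator_of_notMem hpn]
  have hmeasL (n : ℕ) : Measurable fun ω => ∫⁻ p, G n p ∂(Measure.count.restrict (Φ ω)) := by
    have (ω : Ω) : ∫⁻ p, G n p ∂(Measure.count.restrict (Φ ω)) =
        ∑ a ∈ (G n).range.erase 0, a * ((Φ ω ∩ G n ⁻¹' {a}).encard : ℝ≥0∞) := by
      rw [SimpleFunc.lintegral_comp_eq_sum (G n) _ (g := fun x => x) rfl]
      exact Finset.sum_congr rfl fun a _ => by
        rw [count_restrict_apply _ ((G n).measurableSet_fiber a)]
    simp_rw [this]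
    exact Finset.measurable_sum _ fun a _ => ((measurable_of_countable fun k : ℕ∞ => (k : ℝ≥0∞)).comp
      (hΦ.measurable_count _ ((G n).measurableSet_fiber a))).const_mul a
  -- Monotone convergence inside, then dominated convergence outside with the bound 1; only the
  -- simple approximants have to be measurable in `ω`.
  have hleft : Filter.Tendsto
      (fun n => ∫⁻ ω, expNeg (∫⁻ p, G n p ∂(Measure.count.restrict (Φ ω))) ∂μ) Filter.atTop
      (nhds (∫⁻ ω, expNeg (∫⁻ p, g p ∂(Measure.count.restrict (Φ ω))) ∂μ)) := by
    refine tendsto_lintegral_of_dominated_convergence (fun _ => 1)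
      (fun n => measurable_expNeg.comp (hmeasL n))
      (fun n => .of_forall fun ω => expNeg_le_one _) (by simp) (.of_forall fun ω => ?_)
    refine (continuous_expNeg.tendsto _).comp ?_
    exact lintegral_tendsto_of_tendsto_of_monotone (fun n => (G n).measurable.aemeasurable)
      (.of_forall fun p m n hmn => hGmono hmn p) (.of_forall hGtend)
  have hright : Filter.Tendsto
      (fun n => expNeg (ENNReal.ofReal lam * ∫⁻ p, (1 - expNeg (G n p)))) Filter.atTop
      (nhds (expNeg (ENNReal.ofReal lam * ∫⁻ p, (1 - expNeg (g p))))) := by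
    refine (continuous_expNeg.tendsto _).comp
      (ENNReal.Tendsto.const_mul ?_ (Or.inr ENNReal.ofReal_ne_top))
    refine lintegral_tendsto_of_tendsto_of_monotone
      (fun n => (measurable_const.sub (measurable_expNeg.comp (G n).measurable)).aemeasurable)
      (.of_forall fun p m n hmn => tsub_le_tsub_left (expNeg_antitone (hGmono hmn p)) 1)
      (.of_forall fun p => ?_)
    exact ENNReal.Tendsto.sub tendsto_const_nhds ((continuous_expNeg.tendsto _).comp (hGtend p))
      (Or.inl (by simp))
  refine tendsto_nhds_unique hleft (hright.congr fun n => ?_)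
  exact (hΦ.lintegral_expNeg_simpleFunc hlam (G n) (hGvol n)).symm

/-- Bounded sets have finite counts, the origin has area zero, and the configuration is infinite
because the Laplace functional of the constant 1 is e^(-∞) = 0. -/
theorem ae_isRegularConfig (hΦ : IsHomogeneousPPP μ lam Φ) (hlam : 0 < lam) :
    ∀ᵐ ω ∂μ, IsRegularConfig (Φ ω) := by
  have h1 : ∀ᵐ ω ∂μ, ∀ n : ℕ, (Φ ω ∩ Metric.closedBall 0 n).encard ≠ ⊤ :=
    ae_all_iff.2 fun n => hΦ.ae_encard_lt_top hlam.le Metric.isClosed_closedBall.measurableSet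
      measure_closedBall_lt_top.ne
  have h2 : ∀ᵐ ω ∂μ, (Φ ω ∩ {0}).encard = (0 : ℕ) := by
    have hm : MeasurableSet {ω | (Φ ω ∩ {0}).encard = (0 : ℕ)} :=
      hΦ.measurable_count _ (measurableSet_singleton 0) (measurableSet_singleton ((0 : ℕ) : ℕ∞))
    have := hΦ.count_law {0} (measurableSet_singleton 0) (by simp) 0
    exact (prob_compl_eq_zero_iff hm).2 (this.trans (by simp))
  have h3 : ∀ᵐ ω ∂μ, (Φ ω).encard = ⊤ := by
    have h := hΦ.lintegral_expNeg hlam.le (g := fun _ => 1) measurable_const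
    have hone : 1 - expNeg 1 ≠ 0 := by
      have : expNeg 1 < 1 := by
        rw [← ENNReal.ofReal_one, expNeg_ofReal zero_le_one, ENNReal.ofReal_lt_ofReal_iff one_pos]
        exact Real.exp_lt_one_iff.2 (by norm_num)
      exact (tsub_pos_of_lt this).ne'
    have hvol : volume (Set.univ : Set Plane) = ∞ := measure_univ_of_isAddLeftInvariant _
    have hcard (ω : Ω) : Measure.count.restrict (Φ ω) Set.univ = ((Φ ω).encard : ℝ≥0∞) := by
      rw [count_restrict_apply _ MeasurableSet.univ, Set.inter_univ]
    have hlam' : ENNReal.ofReal lam ≠ 0 := by simpa using hlam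
    simp only [lintegral_const, one_mul, hcard, hvol, ENNReal.mul_top hone,
      ENNReal.mul_top hlam', expNeg_top] at h
    have hm : Measurable fun ω => (Φ ω).encard := by
      simpa using hΦ.measurable_count Set.univ MeasurableSet.univ
    filter_upwards [(lintegral_eq_zero_iff (measurable_expNeg.comp
      ((measurable_of_countable fun k : ℕ∞ => (k : ℝ≥0∞)).comp hm))).1 h] with ω hω
    have := expNeg_eq_zero.1 hω
    simpa using this
  filter_upwards [h1, h2, h3] with ω hω1 hω2 hω3
  refine ⟨fun n => Set.encard_ne_top_iff.1 (hω1 n), Set.encard_eq_top_iff.1 hω3, fun h0 => ?_⟩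
  rw [Set.inter_eq_right.2 (Set.singleton_subset_iff.2 h0)] at hω2
  simp at hω2

end IsHomogeneousPPP

/-! ### Polar coordinates and the interference exponent. -/

theorem lintegral_plane_fun_norm {f : ℝ → ℝ≥0∞} (hf : Measurable f) :
    ∫⁻ p : Plane, f ‖p‖ = ∫⁻ r in Set.Ioi (0 : ℝ), ENNReal.ofReal (2 * Real.pi * r) * f r := by
  have hd : Module.finrank ℝ Plane - 1 = 1 := by simp
  have hfs : Measurable fun x : Set.Ioi (0 : ℝ) => f x := hf.comp measurable_subtype_coe
  calc ∫⁻ p : Plane, f ‖p‖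
      = ∫⁻ p in ({(0 : Plane)}ᶜ : Set Plane), f ‖p‖ := by rw [restrict_compl_singleton]
    _ = ∫⁻ p : ({(0 : Plane)}ᶜ : Set Plane), f ‖p.1‖ ∂((volume : Measure Plane).comap (↑)) :=
        (lintegral_subtype_comap (measurableSet_singleton _).compl fun p => f ‖p‖).symm
    _ = ∫⁻ z, f z.2 ∂((volume : Measure Plane).toSphere.prod
          (.volumeIoiPow (Module.finrank ℝ Plane - 1))) := by
        simpa using (volume : Measure Plane).measurePreserving_homeomorphUnitSphereProd.lintegral_comp_emb
          (Homeomorph.measurableEmbedding _) (fun z => f z.2)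
    _ = (volume : Measure Plane).toSphere Set.univ *
          ∫⁻ x : Set.Ioi (0 : ℝ), f x ∂(.volumeIoiPow 1) := by
        rw [hd]
        have := lintegral_prod_mul (μ := (volume : Measure Plane).toSphere)
          (ν := Measure.volumeIoiPow 1) (f := fun _ => 1) (g := fun x => f x)
          measurable_const.aemeasurable hfs.aemeasurable
        simpa using this
    _ = ENNReal.ofReal (2 * Real.pi) *
          ∫⁻ r in Set.Ioi (0 : ℝ), ENNReal.ofReal r * f r := by
        congr 1
        -- The unit circle has mass dimension times area of the unit disc, that is 2π.
        · rw [Measure.toSphere_apply_univ, EuclideanSpace.volume_ball_fin_two,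
            ENNReal.ofReal_mul zero_le_two]
          simp
        · rw [Measure.volumeIoiPow, lintegral_withDensity_eq_lintegral_mul _
            (by fun_prop) hfs]
          rw [← lintegral_subtype_comap measurableSet_Ioi fun r => ENNReal.ofReal r * f r]
          simp
    _ = _ := by
        rw [← lintegral_const_mul _ (by fun_prop)]
        refine lintegral_congr fun r => ?_
        rw [ENNReal.ofReal_mul (p := 2 * Real.pi) (by positivity), mul_assoc]

/-- The mean of `1 / (1 + y * D)` when `D` is the directivity gain of an interfering base
station. -/
noncomputable def attenuation (φ : ℝ) (M : Fin 2 → ℝ) (y : ℝ) : ℝ :=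
  ∑ t : Fin 2, lobeProb φ t / (1 + y * M t)

/-- The exponent of the Laplace transform at `s` of the interference from beyond distance `x`. -/
noncomputable def interferenceExponent (lam P β φ : ℝ) (M : Fin 2 → ℝ) (x s : ℝ) : ℝ :=
  2 * Real.pi * lam * ∫ r in Set.Ioi x, r * (1 - attenuation φ M (s * P * r ^ (-β)))

theorem lobeProb_nonneg {φ : ℝ} (hφ₀ : 0 ≤ φ) (hφ : φ ≤ 2 * Real.pi) (t : Fin 2) :
    0 ≤ lobeProb φ t := by
  have h : φ / (2 * Real.pi) ≤ 1 := (div_le_one (by positivity)).2 hφ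
  fin_cases t
  · simp only [lobeProb, Fin.zero_eta, Matrix.cons_val_zero]
    positivity
  · simpa [lobeProb] using h

theorem sum_lobeProb (φ : ℝ) : ∑ t, lobeProb φ t = 1 := by
  simp [lobeProb]

theorem measurable_attenuation (φ : ℝ) (M : Fin 2 → ℝ) : Measurable (attenuation φ M) := by
  unfold attenuation
  fun_prop

section Attenuation

variable {φ : ℝ} {M : Fin 2 → ℝ}

theorem one_sub_attenuation (hM : ∀ t, 0 ≤ M t) {y : ℝ} (hy : 0 ≤ y) :
    1 - attenuation φ M y = ∑ t, lobeProb φ t * (y * M t / (1 + y * M t)) := by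
  calc 1 - attenuation φ M y = ∑ t, (lobeProb φ t - lobeProb φ t / (1 + y * M t)) := by
        rw [Finset.sum_sub_distrib, sum_lobeProb, attenuation]
    _ = _ := ?_
  refine Finset.sum_congr rfl fun t _ => ?_
  have : 0 < 1 + y * M t := by have := mul_nonneg hy (hM t); linarith
  field_simp
  ring

/-- Strict positivity makes -log of the attenuation a finite cost and permits dividing by the factor
of the nearest station. -/
theorem attenuation_pos (hφ₀ : 0 ≤ φ) (hφ : φ ≤ 2 * Real.pi) (hM : ∀ t, 0 ≤ M t) {y : ℝ}
    (hy : 0 ≤ y) : 0 < attenuation φ M y := by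
  have hp (t : Fin 2) : 0 < 1 + y * M t := by have := mul_nonneg hy (hM t); linarith
  have h0 (t : Fin 2) : 0 ≤ lobeProb φ t / (1 + y * M t) :=
    div_nonneg (lobeProb_nonneg hφ₀ hφ t) (hp t).le
  refine (Finset.sum_nonneg fun t _ => h0 t).lt_of_ne' fun h => ?_
  have hz := (Finset.sum_eq_zero_iff_of_nonneg fun t _ => h0 t).1 h
  have h1 : ∑ t, lobeProb φ t = 0 := Finset.sum_eq_zero fun t ht => by
    simpa [(hp t).ne'] using hz t ht
  rw [sum_lobeProb] at h1
  exact one_ne_zero h1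

theorem attenuation_le_one (hφ₀ : 0 ≤ φ) (hφ : φ ≤ 2 * Real.pi) (hM : ∀ t, 0 ≤ M t) {y : ℝ}
    (hy : 0 ≤ y) : attenuation φ M y ≤ 1 := by
  have := one_sub_attenuation (φ := φ) hM hy
  have h : 0 ≤ ∑ t, lobeProb φ t * (y * M t / (1 + y * M t)) := by
    refine Finset.sum_nonneg fun t _ => mul_nonneg (lobeProb_nonneg hφ₀ hφ t) ?_
    have := mul_nonneg hy (hM t)
    positivity
  linarith

/-- With y proportional to r^(-β), this linear bound supplies the decay that makes the interference
exponent converge. -/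
theorem one_sub_attenuation_le (hφ₀ : 0 ≤ φ) (hφ : φ ≤ 2 * Real.pi) (hM : ∀ t, 0 ≤ M t) {y : ℝ}
    (hy : 0 ≤ y) : 1 - attenuation φ M y ≤ y * ∑ t, lobeProb φ t * M t := by
  rw [one_sub_attenuation hM hy, Finset.mul_sum]
  refine Finset.sum_le_sum fun t _ => ?_
  have h := mul_nonneg hy (hM t)
  calc lobeProb φ t * (y * M t / (1 + y * M t)) ≤ lobeProb φ t * (y * M t) :=
        mul_le_mul_of_nonneg_left (div_le_self h (by linarith)) (lobeProb_nonneg hφ₀ hφ t)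
    _ = y * (lobeProb φ t * M t) := by ring

theorem attenuation_anti (hφ₀ : 0 ≤ φ) (hφ : φ ≤ 2 * Real.pi) (hM : ∀ t, 0 ≤ M t) {y z : ℝ}
    (hy : 0 ≤ y) (hyz : y ≤ z) : attenuation φ M z ≤ attenuation φ M y := by
  refine Finset.sum_le_sum fun t _ => ?_
  have h := mul_nonneg hy (hM t)
  have h2 := mul_le_mul_of_nonneg_right hyz (hM t)
  exact div_le_div_of_nonneg_left (lobeProb_nonneg hφ₀ hφ t) (by linarith) (by linarith)

theorem continuousAt_attenuation (hM : ∀ t, 0 ≤ M t) {y : ℝ} (hy : 0 ≤ y) :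
    ContinuousAt (attenuation φ M) y := by
  unfold attenuation
  refine tendsto_finsetSum _ fun t _ => ?_
  have h := mul_nonneg hy (hM t)
  exact ContinuousAt.div (by fun_prop) (by fun_prop) (by linarith)

end Attenuation

section Exponent

variable {lam P β φ : ℝ} {M : Fin 2 → ℝ}

theorem interference_integrand_nonneg (hP : 0 < P) (hφ₀ : 0 ≤ φ)
    (hφ : φ ≤ 2 * Real.pi) (hM : ∀ t, 0 ≤ M t) {s r : ℝ} (hs : 0 ≤ s) (hr : 0 ≤ r) :
    0 ≤ r * (1 - attenuation φ M (s * P * r ^ (-β))) := by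
  have := attenuation_le_one hφ₀ hφ hM (y := s * P * r ^ (-β)) (by positivity)
  exact mul_nonneg hr (by linarith)

/-- On (0, 1] the integrand is at most 1; beyond 1 it is at most a constant times r^(1 - β),
integrable because β > 2. -/
theorem integrableOn_interference_integrand (hP : 0 < P) (hβ : 2 < β) (hφ₀ : 0 ≤ φ)
    (hφ : φ ≤ 2 * Real.pi) (hM : ∀ t, 0 ≤ M t) {s x : ℝ} (hs : 0 ≤ s) (hx : 0 ≤ x) :
    IntegrableOn (fun r => r * (1 - attenuation φ M (s * P * r ^ (-β)))) (Set.Ioi x) := by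
  have hmeas : Measurable fun r : ℝ => r * (1 - attenuation φ M (s * P * r ^ (-β))) :=
    measurable_id.mul (measurable_const.sub ((measurable_attenuation φ M).comp (by fun_prop)))
  refine IntegrableOn.mono_set ?_ (Set.Ioi_subset_Ioi hx)
  rw [← Set.Ioc_union_Ioi_eq_Ioi zero_le_one]
  refine IntegrableOn.union ?_ ?_
  · refine Integrable.mono' (g := fun _ => (1 : ℝ)) (by simp) hmeas.aestronglyMeasurable ?_
    refine (ae_restrict_iff' measurableSet_Ioc).2 (.of_forall fun r hr => ?_)
    rw [Real.norm_of_nonneg (interference_integrand_nonneg hP hφ₀ hφ hM hs hr.1.le)]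
    have h1 : 0 ≤ s * P * r ^ (-β) := by have := hr.1; positivity
    have := attenuation_le_one hφ₀ hφ hM h1
    have := attenuation_pos hφ₀ hφ hM h1
    nlinarith [hr.1, hr.2]
  · have hi : IntegrableOn (fun r : ℝ => (s * P * ∑ t, lobeProb φ t * M t) * r ^ (1 - β))
        (Set.Ioi 1) :=
      (integrableOn_Ioi_rpow_of_lt (by linarith) one_pos).const_mul _
    refine Integrable.mono' hi hmeas.aestronglyMeasurable ?_
    refine (ae_restrict_iff' measurableSet_Ioi).2 (.of_forall fun r hr => ?_)
    have hr0 : 0 < r := one_pos.trans hr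
    rw [Real.norm_of_nonneg (interference_integrand_nonneg hP hφ₀ hφ hM hs hr0.le)]
    have := one_sub_attenuation_le hφ₀ hφ hM (y := s * P * r ^ (-β)) (by positivity)
    calc r * (1 - attenuation φ M (s * P * r ^ (-β)))
        ≤ r * (s * P * r ^ (-β) * ∑ t, lobeProb φ t * M t) := by gcongr
      _ = _ := by
        rw [sub_eq_add_neg, Real.rpow_add hr0, Real.rpow_one]
        ring

theorem interferenceExponent_nonneg (hlam : 0 < lam) (hP : 0 < P) (hφ₀ : 0 ≤ φ)
    (hφ : φ ≤ 2 * Real.pi) (hM : ∀ t, 0 ≤ M t) {s x : ℝ} (hs : 0 ≤ s) (hx : 0 ≤ x) :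
    0 ≤ interferenceExponent lam P β φ M x s := by
  refine mul_nonneg (by positivity) (setIntegral_nonneg measurableSet_Ioi fun r hr => ?_)
  exact interference_integrand_nonneg hP hφ₀ hφ hM hs (hx.trans (le_of_lt hr))

theorem interferenceExponent_zero (lam P β φ : ℝ) (M : Fin 2 → ℝ) (x : ℝ) :
    interferenceExponent lam P β φ M x 0 = 0 := by
  have h := sum_lobeProb φ
  rw [Fin.sum_univ_two] at h
  simp [interferenceExponent, attenuation, h]

/-- The integrand increases with `s`, so its value at `s + 1` dominates nearby arguments. The lemma
serves the limit `s → 0` and the approximation of arguments depending on the distance. -/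
theorem continuousWithinAt_interferenceExponent (hP : 0 < P) (hβ : 2 < β)
    (hφ₀ : 0 ≤ φ) (hφ : φ ≤ 2 * Real.pi) (hM : ∀ t, 0 ≤ M t) {s x : ℝ} (hs : 0 ≤ s)
    (hx : 0 ≤ x) :
    ContinuousWithinAt (fun s => interferenceExponent lam P β φ M x s) (Set.Ici 0) s := by
  refine ContinuousWithinAt.mul continuousWithinAt_const ?_
  refine continuousWithinAt_of_dominated
    (bound := fun r => r * (1 - attenuation φ M ((s + 1) * P * r ^ (-β)))) ?_ ?_
    (integrableOn_interference_integrand hP hβ hφ₀ hφ hM (by linarith) hx) ?_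
  · refine .of_forall fun s => Measurable.aestronglyMeasurable ?_
    exact measurable_id.mul
      (measurable_const.sub ((measurable_attenuation φ M).comp (by fun_prop)))
  · have h1 : ∀ᶠ u in nhdsWithin s (Set.Ici 0), u < s + 1 :=
      nhdsWithin_le_nhds (Iio_mem_nhds (by linarith))
    filter_upwards [h1, self_mem_nhdsWithin] with u hu hu0
    refine (ae_restrict_iff' measurableSet_Ioi).2 (.of_forall fun r hr => ?_)
    have hu0 : 0 ≤ u := hu0
    have hr0 : 0 < r := hx.trans_lt hr
    rw [Real.norm_of_nonneg (interference_integrand_nonneg hP hφ₀ hφ hM hu0 hr0.le)]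
    have := attenuation_anti hφ₀ hφ hM (y := u * P * r ^ (-β))
      (z := (s + 1) * P * r ^ (-β)) (by positivity) (by gcongr)
    gcongr
  · refine (ae_restrict_iff' measurableSet_Ioi).2 (.of_forall fun r hr => ?_)
    have hr0 : 0 < r := hx.trans_lt hr
    refine ContinuousAt.continuousWithinAt ?_
    refine ContinuousAt.mul continuousAt_const (ContinuousAt.sub continuousAt_const ?_)
    exact ContinuousAt.comp (f := fun s : ℝ => s * P * r ^ (-β)) (g := attenuation φ M)
      (continuousAt_attenuation hM (by positivity)) (by fun_prop)

/-- Joint measurability is required because in the coverage formula the Laplace argument is a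
function of the distance. -/
theorem measurable_interferenceExponent (lam P β φ : ℝ) (M : Fin 2 → ℝ) :
    Measurable fun z : ℝ × ℝ => interferenceExponent lam P β φ M z.1 z.2 := by
  have h : (fun z : ℝ × ℝ => interferenceExponent lam P β φ M z.1 z.2) =
      fun z => 2 * Real.pi * lam * ∫ r, (if z.1 < r then
        r * (1 - attenuation φ M (z.2 * P * r ^ (-β))) else 0) := by
    ext z
    rw [interferenceExponent, ← integral_indicator measurableSet_Ioi]
    rfl
  rw [h]
  refine Measurable.const_mul ?_ _
  refine (StronglyMeasurable.integral_prod_right (ν := volume) (f := fun (z : ℝ × ℝ) (r : ℝ) =>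
    if z.1 < r then r * (1 - attenuation φ M (z.2 * P * r ^ (-β))) else 0) ?_).measurable
  refine Measurable.stronglyMeasurable ?_
  refine Measurable.ite (measurableSet_lt (by fun_prop) (by fun_prop)) ?_ measurable_const
  exact measurable_snd.mul
    (measurable_const.sub ((measurable_attenuation φ M).comp (by fun_prop)))

theorem hasDerivAt_interferenceExponent (hP : 0 < P) (hβ : 2 < β)
    (hφ₀ : 0 ≤ φ) (hφ : φ ≤ 2 * Real.pi) (hM : ∀ t, 0 ≤ M t) {s x : ℝ} (hs : 0 ≤ s)
    (hx : 0 < x) :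
    HasDerivAt (fun x => interferenceExponent lam P β φ M x s)
      (-(2 * Real.pi * lam * (x * (1 - attenuation φ M (s * P * x ^ (-β)))))) x := by
  set g : ℝ → ℝ := fun r => r * (1 - attenuation φ M (s * P * r ^ (-β))) with hg
  have hgm : Measurable g := measurable_id.mul
    (measurable_const.sub ((measurable_attenuation φ M).comp (by fun_prop)))
  have hgi (y : ℝ) (hy : 0 ≤ y) : IntegrableOn g (Set.Ioi y) :=
    integrableOn_interference_integrand hP hβ hφ₀ hφ hM hs hy
  have hgc : ContinuousAt g x := by
    refine ContinuousAt.mul continuousAt_id (ContinuousAt.sub continuousAt_const ?_)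
    refine ContinuousAt.comp (f := fun r : ℝ => s * P * r ^ (-β)) (g := attenuation φ M)
      (continuousAt_attenuation hM (by positivity)) ?_
    exact ContinuousAt.mul continuousAt_const (Real.continuousAt_rpow_const _ _ (Or.inl hx.ne'))
  have hint : IntervalIntegrable g volume 0 x := by
    rw [intervalIntegrable_iff_integrableOn_Ioc_of_le hx.le]
    exact (hgi 0 le_rfl).mono_set Set.Ioc_subset_Ioi_self
  have hd := intervalIntegral.integral_hasDerivAt_right hint
    (hgm.stronglyMeasurable.stronglyMeasurableAtFilter) hgc
  have hd2 := ((hd.const_sub (∫ r in Set.Ioi (0 : ℝ), g r)).const_mul (2 * Real.pi * lam))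
  rw [mul_neg] at hd2
  refine hd2.congr_of_eventuallyEq ?_
  filter_upwards [Ioi_mem_nhds hx] with y hy
  rw [interferenceExponent, ← intervalIntegral.integral_interval_add_Ioi (hgi 0 le_rfl)
    (hgi y (le_of_lt hy))]
  simp [hg]

/-- At `x = 0` the power r^(-β) is singular and differentiability is not available from the previous
lemma; continuity of the primitive of an integrable function suffices. -/
theorem continuousWithinAt_interferenceExponent_left (hP : 0 < P) (hβ : 2 < β)
    (hφ₀ : 0 ≤ φ) (hφ : φ ≤ 2 * Real.pi) (hM : ∀ t, 0 ≤ M t) {s x : ℝ} (hs : 0 ≤ s)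
    (hx : 0 ≤ x) :
    ContinuousWithinAt (fun x => interferenceExponent lam P β φ M x s) (Set.Ici x) x := by
  rcases hx.eq_or_lt with rfl | hx
  · set g : ℝ → ℝ := fun r => r * (1 - attenuation φ M (s * P * r ^ (-β))) with hg
    have hgi (y : ℝ) (hy : 0 ≤ y) : IntegrableOn g (Set.Ioi y) :=
      integrableOn_interference_integrand hP hβ hφ₀ hφ hM hs hy
    have hc : ContinuousOn (fun y => ∫ r in (0 : ℝ)..y, g r) (Set.uIcc 0 1) := by
      refine intervalIntegral.continuousOn_primitive_interval ?_
      rw [Set.uIcc_of_le zero_le_one, integrableOn_Icc_iff_integrableOn_Ioc]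
      exact (hgi 0 le_rfl).mono_set Set.Ioc_subset_Ioi_self
    have hc0 : ContinuousWithinAt (fun y => ∫ r in (0 : ℝ)..y, g r) (Set.Ici 0) 0 := by
      refine (hc 0 Set.left_mem_uIcc).mono_of_mem_nhdsWithin ?_
      rw [Set.uIcc_of_le zero_le_one]
      exact Icc_mem_nhdsGE one_pos
    refine ContinuousWithinAt.congr (f := fun y => 2 * Real.pi * lam *
      ((∫ r in Set.Ioi (0 : ℝ), g r) - ∫ r in (0 : ℝ)..y, g r))
      (continuousWithinAt_const.mul (continuousWithinAt_const.sub hc0)) (fun y hy => ?_) ?_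
    · rw [interferenceExponent, ← intervalIntegral.integral_interval_add_Ioi (hgi 0 le_rfl)
        (hgi y hy)]
      simp [hg]
    · simp [interferenceExponent, hg]
  · exact (hasDerivAt_interferenceExponent hP hβ hφ₀ hφ hM hs hx).continuousAt.continuousWithinAt

/-- The void probability of the disc of radius `x` times the Laplace transform of the interference
from beyond `x`, as an integral over the distance of the nearest base station. -/
theorem lintegral_Ioi_attenuation_mul (hlam : 0 < lam) (hP : 0 < P) (hβ : 2 < β)
    (hφ₀ : 0 ≤ φ) (hφ : φ ≤ 2 * Real.pi) (hM : ∀ t, 0 ≤ M t) {s x : ℝ} (hs : 0 ≤ s)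
    (hx : 0 ≤ x) :
    ∫⁻ r in Set.Ioi x, ENNReal.ofReal (attenuation φ M (s * P * r ^ (-β)) *
        (nearestPDF lam r * Real.exp (-interferenceExponent lam P β φ M r s))) =
      ENNReal.ofReal
        (Real.exp (-(Real.pi * lam * x ^ 2 + interferenceExponent lam P β φ M x s))) := by
  -- The derivative of πλr² + E(r) is 2πλr - 2πλr (1 - A(r)) = 2πλr A(r); hence -F' is exactly the
  -- integrand, and F vanishes at infinity.
  set F : ℝ → ℝ := fun x =>
    Real.exp (-(Real.pi * lam * x ^ 2 + interferenceExponent lam P β φ M x s)) with hF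
  set F' : ℝ → ℝ := fun r => -(attenuation φ M (s * P * r ^ (-β)) *
        (nearestPDF lam r * Real.exp (-interferenceExponent lam P β φ M r s))) with hF'
  have hcont : ContinuousWithinAt F (Set.Ici x) x := by
    refine (Real.continuous_exp.continuousAt.comp_continuousWithinAt ?_)
    refine ContinuousWithinAt.neg (ContinuousWithinAt.add
      (Continuous.continuousWithinAt (by fun_prop)) ?_)
    exact continuousWithinAt_interferenceExponent_left hP hβ hφ₀ hφ hM hs hx
  have hderiv : ∀ r ∈ Set.Ioi x, HasDerivAt F (F' r) r := by
    intro r hr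
    have hr0 : 0 < r := hx.trans_lt hr
    have h1 := hasDerivAt_interferenceExponent (lam := lam) hP hβ hφ₀ hφ hM hs hr0
    have h2 : HasDerivAt (fun r : ℝ => Real.pi * lam * r ^ 2) (Real.pi * lam * (2 * r)) r := by
      simpa using (hasDerivAt_pow 2 r).const_mul (Real.pi * lam)
    have h3 := ((h2.add h1).neg).exp
    refine h3.congr_deriv ?_
    simp only [hF', nearestPDF, Pi.add_apply, Pi.neg_apply, neg_add, Real.exp_add]
    ring
  have hF'0 : ∀ r ∈ Set.Ioi x, F' r ≤ 0 := by
    intro r hr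
    have hr0 : 0 < r := hx.trans_lt hr
    have := attenuation_pos hφ₀ hφ hM (y := s * P * r ^ (-β)) (by positivity)
    simp only [hF', nearestPDF, Left.neg_nonpos_iff]
    positivity
  have hlim : Filter.Tendsto F Filter.atTop (nhds 0) := by
    refine squeeze_zero' (g := fun x => Real.exp (-(Real.pi * lam * x ^ 2)))
      (.of_forall fun _ => (Real.exp_pos _).le) ?_ ?_
    · filter_upwards [Filter.eventually_ge_atTop 0] with y hy
      have := interferenceExponent_nonneg (β := β) hlam hP hφ₀ hφ hM hs hy
      exact Real.exp_le_exp.2 (by linarith)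
    · refine Real.tendsto_exp_neg_atTop_nhds_zero.comp ?_
      exact (Filter.tendsto_pow_atTop two_ne_zero).const_mul_atTop (by positivity)
  have hI := integral_Ioi_of_hasDerivAt_of_nonpos hcont hderiv hF'0 hlim
  have hint := integrableOn_Ioi_deriv_of_nonpos hcont hderiv hF'0 hlim
  have h := ofReal_integral_eq_lintegral_ofReal hint.neg
    ((ae_restrict_iff' measurableSet_Ioi).2 (.of_forall fun r hr => neg_nonneg.2 (hF'0 r hr)))
  have hI' : ∫ r in Set.Ioi x, (-F') r = F x := by
    simp only [Pi.neg_apply, integral_neg, hI, zero_sub, neg_neg]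
  rw [hI'] at h
  simp only [Pi.neg_apply, hF', neg_neg] at h
  exact h.symm

end Exponent

/-! ### Joint law of the nearest distance and the interference. -/

section NearestDistance

variable {Ω : Type*} [MeasurableSpace Ω] {μ : Measure Ω} {lam P β φ : ℝ} {M : Fin 2 → ℝ}
  {Φ : Ω → Set Plane}

/-- The exponential cost of one interfering base station at distance `r`, averaged over its fading
and its gain. -/
noncomputable def attenuationCost (P β φ : ℝ) (M : Fin 2 → ℝ) (s r : ℝ) : ℝ≥0∞ :=
  ENNReal.ofReal (-Real.log (attenuation φ M (s * P * r ^ (-β))))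

theorem measurable_attenuationCost (P β φ : ℝ) (M : Fin 2 → ℝ) (s : ℝ) :
    Measurable (attenuationCost P β φ M s) :=
  (((measurable_attenuation φ M).comp (by fun_prop)).log.neg).ennreal_ofReal

theorem expNeg_attenuationCost (hP : 0 < P) (hφ₀ : 0 ≤ φ) (hφ : φ ≤ 2 * Real.pi)
    (hM : ∀ t, 0 ≤ M t) {s r : ℝ} (hs : 0 ≤ s) (hr : 0 ≤ r) :
    expNeg (attenuationCost P β φ M s r) =
      ENNReal.ofReal (attenuation φ M (s * P * r ^ (-β))) := by
  have hy : 0 ≤ s * P * r ^ (-β) := by positivity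
  have h0 := attenuation_pos hφ₀ hφ hM hy
  rw [attenuationCost, expNeg_ofReal, neg_neg, Real.exp_log h0]
  exact neg_nonneg.2 (Real.log_nonpos h0.le (attenuation_le_one hφ₀ hφ hM hy))

theorem lintegral_Ioc_two_pi_mul {x : ℝ} (hx : 0 ≤ x) :
    ∫⁻ r in Set.Ioc 0 x, ENNReal.ofReal (2 * Real.pi * r) = ENNReal.ofReal (Real.pi * x ^ 2) := by
  have hi : IntegrableOn (fun r : ℝ => 2 * Real.pi * r) (Set.Ioc 0 x) :=
    (Continuous.integrableOn_Icc (by fun_prop)).mono_set Set.Ioc_subset_Icc_self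
  rw [← ofReal_integral_eq_lintegral_ofReal hi
    ((ae_restrict_iff' measurableSet_Ioc).2 (.of_forall fun r hr => by
      have := hr.1; simp only [Pi.zero_apply]; positivity)),
    ← intervalIntegral.integral_of_le hx, intervalIntegral.integral_const_mul, integral_id]
  congr 1
  ring

/-- Infinite cost makes the integrand 1 on the disc, which contributes its area πx²; outside, the
integrand is one minus the attenuation. -/
theorem lintegral_one_sub_expNeg_beyond (hlam : 0 < lam) (hP : 0 < P) (hβ : 2 < β)
    (hφ₀ : 0 ≤ φ) (hφ : φ ≤ 2 * Real.pi) (hM : ∀ t, 0 ≤ M t) {s x : ℝ} (hs : 0 ≤ s)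
    (hx : 0 ≤ x) :
    ENNReal.ofReal lam * ∫⁻ p : Plane,
        (1 - expNeg (if ‖p‖ ≤ x then ∞ else attenuationCost P β φ M s ‖p‖)) =
      ENNReal.ofReal (Real.pi * lam * x ^ 2 + interferenceExponent lam P β φ M x s) := by
  have hfm : Measurable fun r : ℝ =>
      1 - expNeg (if r ≤ x then ∞ else attenuationCost P β φ M s r) :=
    measurable_const.sub (measurable_expNeg.comp
      (Measurable.ite measurableSet_Iic measurable_const (measurable_attenuationCost P β φ M s)))
  rw [lintegral_plane_fun_norm hfm, ← Set.Ioc_union_Ioi_eq_Ioi hx,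
    lintegral_union measurableSet_Ioi (Set.Ioc_disjoint_Ioi le_rfl)]
  have h1 : ∫⁻ r in Set.Ioc 0 x, ENNReal.ofReal (2 * Real.pi * r) *
      (1 - expNeg (if r ≤ x then ∞ else attenuationCost P β φ M s r)) =
      ENNReal.ofReal (Real.pi * x ^ 2) := by
    rw [← lintegral_Ioc_two_pi_mul hx]
    refine setLIntegral_congr_fun measurableSet_Ioc fun r hr => ?_
    simp [hr.2, expNeg_top]
  have h2 : ∫⁻ r in Set.Ioi x, ENNReal.ofReal (2 * Real.pi * r) *
      (1 - expNeg (if r ≤ x then ∞ else attenuationCost P β φ M s r)) =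
      ENNReal.ofReal (2 * Real.pi *
        ∫ r in Set.Ioi x, r * (1 - attenuation φ M (s * P * r ^ (-β)))) := by
    rw [← integral_const_mul, ofReal_integral_eq_lintegral_ofReal
      ((integrableOn_interference_integrand hP hβ hφ₀ hφ hM hs hx).const_mul _)]
    · refine setLIntegral_congr_fun measurableSet_Ioi fun r hr => ?_
      have hr' : x < r := hr
      have hr0 : 0 < r := hx.trans_lt hr
      have hy : 0 ≤ s * P * r ^ (-β) := by positivity
      simp only [hr'.not_ge, if_false]
      rw [expNeg_attenuationCost hP hφ₀ hφ hM hs hr0.le, ← ENNReal.ofReal_one,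
        ← ENNReal.ofReal_sub _ (attenuation_pos hφ₀ hφ hM hy).le,
        ← ENNReal.ofReal_mul (by positivity), mul_assoc]
    · refine (ae_restrict_iff' measurableSet_Ioi).2 (.of_forall fun r hr => ?_)
      exact mul_nonneg (by positivity)
        (interference_integrand_nonneg hP hφ₀ hφ hM hs (hx.trans (le_of_lt hr)))
  have h3 : 0 ≤ 2 * Real.pi * ∫ r in Set.Ioi x, r * (1 - attenuation φ M (s * P * r ^ (-β))) :=
    mul_nonneg (by positivity) (setIntegral_nonneg measurableSet_Ioi fun r hr =>
      interference_integrand_nonneg hP hφ₀ hφ hM hs (hx.trans (le_of_lt hr)))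
  rw [h1, h2, ← ENNReal.ofReal_add (by positivity) h3, ← ENNReal.ofReal_mul hlam.le,
    interferenceExponent]
  congr 1
  ring

/-- Infinite cost on the disc annihilates every configuration with a point there, so a single
Laplace functional yields the event R₁ > x together with the product of all attenuations. -/
theorem lintegral_indicator_expNeg_tsum [IsProbabilityMeasure μ]
    (hΦ : IsHomogeneousPPP μ lam Φ) (hlam : 0 < lam) (hP : 0 < P)
    (hβ : 2 < β) (hφ₀ : 0 ≤ φ) (hφ : φ ≤ 2 * Real.pi) (hM : ∀ t, 0 ≤ M t) {s x : ℝ} (hs : 0 ≤ s)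
    (hx : 0 ≤ x) :
    ∫⁻ ω, (Set.Ioi x).indicator 1 (nearestDist (Φ ω) 0) *
        expNeg (∑' l, attenuationCost P β φ M s (nearestDist (Φ ω) l)) ∂μ =
      ENNReal.ofReal
        (Real.exp (-(Real.pi * lam * x ^ 2 + interferenceExponent lam P β φ M x s))) := by
  set fx : ℝ → ℝ≥0∞ := fun r => if r ≤ x then ∞ else attenuationCost P β φ M s r with hfx
  have hfxm : Measurable fx :=
    Measurable.ite measurableSet_Iic measurable_const (measurable_attenuationCost P β φ M s)
  have h := hΦ.lintegral_expNeg hlam.le (hfxm.comp measurable_norm)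
  have hint := lintegral_one_sub_expNeg_beyond hlam hP hβ hφ₀ hφ hM hs hx
  have hE := interferenceExponent_nonneg (β := β) hlam hP hφ₀ hφ hM hs hx
  simp only [Function.comp_apply, hfx] at h
  rw [hint, expNeg_ofReal (by positivity)] at h
  rw [← h]
  refine lintegral_congr_ae ?_
  filter_upwards [hΦ.ae_isRegularConfig hlam] with ω hω
  rw [← hω.tsum_nearestDist hfxm]
  by_cases hR : x < nearestDist (Φ ω) 0
  · rw [Set.indicator_of_mem (Set.mem_Ioi.2 hR), Pi.one_apply, one_mul]
    congr 1
    refine tsum_congr fun l => ?_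
    simp [hfx, (hR.trans_le (hω.nearestDist_mono (zero_le (a := l)))).not_ge]
  · rw [Set.indicator_of_notMem (mt Set.mem_Ioi.1 hR), zero_mul]
    have : ∑' l, fx (nearestDist (Φ ω) l) = ∞ :=
      ENNReal.tsum_eq_top_of_eq_top ⟨0, by simp [hfx, not_lt.1 hR]⟩
    rw [this, expNeg_top]

/-- The law of the nearest distance, weighted with the Laplace transform of a shot noise of all
distances. -/
theorem map_nearestDist_withDensity [IsProbabilityMeasure μ]
    (hΦ : IsHomogeneousPPP μ lam Φ) (hlam : 0 < lam) (hP : 0 < P)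
    (hβ : 2 < β) (hφ₀ : 0 ≤ φ) (hφ : φ ≤ 2 * Real.pi) (hM : ∀ t, 0 ≤ M t) {s : ℝ} (hs : 0 ≤ s) :
    (μ.withDensity fun ω => expNeg (∑' l, attenuationCost P β φ M s (nearestDist (Φ ω) l))).map
        (fun ω => nearestDist (Φ ω) 0) =
      (volume.restrict (Set.Ioi 0)).withDensity fun r =>
        ENNReal.ofReal (attenuation φ M (s * P * r ^ (-β)) *
          (nearestPDF lam r * Real.exp (-interferenceExponent lam P β φ M r s))) := by
  have hRm (l : ℕ) : Measurable fun ω => nearestDist (Φ ω) l :=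
    measurable_nearestDist hΦ.measurable_count l
  set Z : Ω → ℝ≥0∞ := fun ω => expNeg (∑' l, attenuationCost P β φ M s (nearestDist (Φ ω) l)) with hZ
  have hZm : Measurable Z := measurable_expNeg.comp
    (Measurable.tsum fun l => (measurable_attenuationCost P β φ M s).comp (hRm l))
  set dens : ℝ → ℝ≥0∞ := fun r => ENNReal.ofReal (attenuation φ M (s * P * r ^ (-β)) *
        (nearestPDF lam r * Real.exp (-interferenceExponent lam P β φ M r s))) with hdens
  set ν : Measure ℝ := (μ.withDensity Z).map fun ω => nearestDist (Φ ω) 0 with hν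
  set ν' : Measure ℝ := (volume.restrict (Set.Ioi 0)).withDensity dens with hν'
  have hpos : ∀ᵐ ω ∂μ, 0 < nearestDist (Φ ω) 0 := by
    filter_upwards [hΦ.ae_isRegularConfig hlam] with ω hω using hω.nearestDist_pos 0
  set G : ℝ → ℝ≥0∞ := fun x => ENNReal.ofReal
    (Real.exp (-(Real.pi * lam * x ^ 2 + interferenceExponent lam P β φ M x s))) with hG
  have hνs (B : Set ℝ) (hB : MeasurableSet B) :
      ν B = ∫⁻ ω, B.indicator 1 (nearestDist (Φ ω) 0) * Z ω ∂μ := by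
    rw [hν, Measure.map_apply (hRm 0) hB, withDensity_apply _ (hRm 0 hB),
      ← lintegral_indicator (hRm 0 hB)]
    refine lintegral_congr fun ω => ?_
    by_cases h : nearestDist (Φ ω) 0 ∈ B <;> simp [h]
  -- Agreement with the half-line is asked only on positive reals, where the distance lives; this
  -- covers the whole line (`x = 0`) and half-lines starting at a negative number.
  have hν1 {B : Set ℝ} (hB : MeasurableSet B) {x : ℝ} (hx : 0 ≤ x)
      (h : ∀ r, 0 < r → (r ∈ B ↔ x < r)) : ν B = G x := by
    rw [hνs B hB]
    refine (lintegral_congr_ae ?_).trans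
      (lintegral_indicator_expNeg_tsum hΦ hlam hP hβ hφ₀ hφ hM hs hx)
    filter_upwards [hpos] with ω hω
    congr 1
    simp only [Set.indicator, h _ hω, Set.mem_Ioi]
  have hν'1 {B : Set ℝ} (hB : MeasurableSet B) {x : ℝ} (hx : 0 ≤ x)
      (h : ∀ r, 0 < r → (r ∈ B ↔ x < r)) : ν' B = G x := by
    have hBx : B ∩ Set.Ioi 0 = Set.Ioi x := by
      ext r
      refine ⟨fun hr => (h r hr.2).1 hr.1, fun hr => ?_⟩
      have hr0 : 0 < r := hx.trans_lt hr
      exact ⟨(h r hr0).2 hr, hr0⟩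
    rw [hν', withDensity_apply _ hB, Measure.restrict_restrict hB, hBx]
    exact lintegral_Ioi_attenuation_mul hlam hP hβ hφ₀ hφ hM hs hx
  have huniv : ν Set.univ = G 0 := hν1 MeasurableSet.univ le_rfl (by simp)
  have huniv' : ν' Set.univ = G 0 := hν'1 MeasurableSet.univ le_rfl (by simp)
  have : IsFiniteMeasure ν := ⟨by rw [huniv]; exact ENNReal.ofReal_lt_top⟩
  have : IsFiniteMeasure ν' := ⟨by rw [huniv']; exact ENNReal.ofReal_lt_top⟩
  have hIoi (b : ℝ) : ∀ r : ℝ, 0 < r → (r ∈ Set.Ioi b ↔ max b 0 < r) := by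
    intro r hr
    simp [hr]
  refine Measure.ext_of_Iic _ _ fun b => ?_
  rw [← Set.compl_Ioi, measure_compl measurableSet_Ioi (measure_ne_top _ _),
      measure_compl measurableSet_Ioi (measure_ne_top _ _), huniv, huniv',
      hν1 measurableSet_Ioi (le_max_right b 0) (hIoi b),
      hν'1 measurableSet_Ioi (le_max_right b 0) (hIoi b)]

/-- The joint law of the nearest distance and the Laplace transform of a shot noise of the other
distances. -/
theorem lintegral_mul_expNeg_tsum_succ [IsProbabilityMeasure μ]
    (hΦ : IsHomogeneousPPP μ lam Φ) (hlam : 0 < lam) (hP : 0 < P)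
    (hβ : 2 < β) (hφ₀ : 0 ≤ φ) (hφ : φ ≤ 2 * Real.pi) (hM : ∀ t, 0 ≤ M t) {s : ℝ} (hs : 0 ≤ s)
    {g : ℝ → ℝ≥0∞} (hg : Measurable g) :
    ∫⁻ ω, g (nearestDist (Φ ω) 0) *
        expNeg (∑' l, attenuationCost P β φ M s (nearestDist (Φ ω) (l + 1))) ∂μ =
      ∫⁻ r in Set.Ioi (0 : ℝ), g r *
        ENNReal.ofReal (nearestPDF lam r * Real.exp (-interferenceExponent lam P β φ M r s)) := by
  have hRm (l : ℕ) : Measurable fun ω => nearestDist (Φ ω) l :=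
    measurable_nearestDist hΦ.measurable_count l
  set Z : Ω → ℝ≥0∞ := fun ω => expNeg (∑' l, attenuationCost P β φ M s (nearestDist (Φ ω) l)) with hZ
  have hZm : Measurable Z := measurable_expNeg.comp
    (Measurable.tsum fun l => (measurable_attenuationCost P β φ M s).comp (hRm l))
  set dens : ℝ → ℝ≥0∞ := fun r => ENNReal.ofReal (attenuation φ M (s * P * r ^ (-β)) *
        (nearestPDF lam r * Real.exp (-interferenceExponent lam P β φ M r s))) with hdens
  have hpdfm : Measurable (nearestPDF lam) := by unfold nearestPDF; fun_prop
  have hexpm : Measurable fun r => Real.exp (-interferenceExponent lam P β φ M r s) :=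
    (((measurable_interferenceExponent lam P β φ M).comp (by fun_prop :
      Measurable fun r : ℝ => (r, s))).neg).exp
  have hdensm : Measurable dens :=
    (((measurable_attenuation φ M).comp (by fun_prop)).mul (hpdfm.mul hexpm)).ennreal_ofReal
  -- Dividing by the factor of the nearest station turns the product over all stations into the
  -- product over the interferers, and cancels the attenuation in the density.
  set k : ℝ → ℝ≥0∞ := fun r => g r * (expNeg (attenuationCost P β φ M s r))⁻¹ with hk
  have hkm : Measurable k :=
    hg.mul ((measurable_expNeg.comp (measurable_attenuationCost P β φ M s)).inv)
  calc ∫⁻ ω, g (nearestDist (Φ ω) 0) *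
        expNeg (∑' l, attenuationCost P β φ M s (nearestDist (Φ ω) (l + 1))) ∂μ
      = ∫⁻ ω, Z ω * k (nearestDist (Φ ω) 0) ∂μ := by
        refine lintegral_congr fun ω => ?_
        have h0 : expNeg (attenuationCost P β φ M s (nearestDist (Φ ω) 0)) ≠ 0 :=
          mt expNeg_eq_zero.1 ENNReal.ofReal_ne_top
        have h1 : Z ω = expNeg (attenuationCost P β φ M s (nearestDist (Φ ω) 0)) *
            expNeg (∑' l, attenuationCost P β φ M s (nearestDist (Φ ω) (l + 1))) := by
          rw [← expNeg_add]
          exact congrArg expNeg (tsum_eq_zero_add' ENNReal.summable)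
        rw [h1, mul_right_comm]
        simp only [hk]
        rw [mul_left_comm (expNeg _), ENNReal.mul_inv_cancel h0 (expNeg_ne_top _), mul_one]
    _ = ∫⁻ r, k r ∂(μ.withDensity Z).map (fun ω => nearestDist (Φ ω) 0) := by
        rw [lintegral_map hkm (hRm 0)]
        exact (lintegral_withDensity_eq_lintegral_mul _ hZm (hkm.comp (hRm 0))).symm
    _ = ∫⁻ r in Set.Ioi (0 : ℝ), dens r * k r := by
        rw [map_nearestDist_withDensity hΦ hlam hP hβ hφ₀ hφ hM hs,
          lintegral_withDensity_eq_lintegral_mul _ hdensm hkm]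
        rfl
    _ = _ := by
        refine setLIntegral_congr_fun measurableSet_Ioi fun r hr => ?_
        have hr0 : 0 < r := hr
        have ha := attenuation_pos hφ₀ hφ hM (y := s * P * r ^ (-β)) (by positivity)
        simp only [hdens, hk]
        rw [expNeg_attenuationCost hP hφ₀ hφ hM hs hr0.le, ENNReal.ofReal_mul ha.le]
        calc _ = g r * ENNReal.ofReal (nearestPDF lam r *
                Real.exp (-interferenceExponent lam P β φ M r s)) *
                (ENNReal.ofReal (attenuation φ M (s * P * r ^ (-β))) *
                (ENNReal.ofReal (attenuation φ M (s * P * r ^ (-β))))⁻¹) := by ring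
          _ = _ := by
            rw [ENNReal.mul_inv_cancel (by simpa using ha) ENNReal.ofReal_ne_top, mul_one]

theorem map_nearestDist_zero [IsProbabilityMeasure μ] (hΦ : IsHomogeneousPPP μ lam Φ)
    (hlam : 0 < lam) :
    μ.map (fun ω => nearestDist (Φ ω) 0) = (volume.restrict (Set.Ioi 0)).withDensity
      (fun r => ENNReal.ofReal (nearestPDF lam r)) := by
  have hRm : Measurable fun ω => nearestDist (Φ ω) 0 :=
    measurable_nearestDist hΦ.measurable_count 0
  ext B hB
  -- At `s = 0` the interference weight is trivial; the other parameters are arbitrary admissible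
  -- values.
  have h := lintegral_mul_expNeg_tsum_succ (M := fun _ => 0) hΦ hlam one_pos
    (by norm_num : (2 : ℝ) < 3) le_rfl (by positivity : (0 : ℝ) ≤ 2 * Real.pi) (fun _ => le_rfl)
    le_rfl ((measurable_const (a := (1 : ℝ≥0∞))).indicator hB)
  have h0 (r : ℝ) : attenuationCost 1 3 0 (fun _ => 0) 0 r = 0 := by
    have := sum_lobeProb 0
    rw [Fin.sum_univ_two] at this
    simp [attenuationCost, attenuation, this]
  simp only [h0, tsum_zero, expNeg_zero, mul_one, interferenceExponent_zero, neg_zero,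
    Real.exp_zero] at h
  rw [Measure.map_apply hRm hB, withDensity_apply _ hB, ← lintegral_indicator hB,
    ← lintegral_indicator_one (hRm hB)]
  refine Eq.trans ?_ (h.trans ?_)
  · rfl
  · refine lintegral_congr fun r => ?_
    by_cases hr : r ∈ B <;> simp [hr]

end NearestDistance

/-! ### Averaging independent variables: series, exponential law, gain law. -/

/-- Fubini for the product law: `Y` is frozen at the outer sample point while `X` is averaged. All
partial averaging in the model goes through this form. -/
theorem _root_.ProbabilityTheory.IndepFun.lintegral_eq_lintegral_lintegral {Ω E F : Type*}
    [MeasurableSpace Ω] [MeasurableSpace E] [MeasurableSpace F] {μ : Measure Ω}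
    [IsProbabilityMeasure μ] {X : Ω → E} {Y : Ω → F} (h : IndepFun X Y μ) (hX : Measurable X)
    (hY : Measurable Y) {f : E → F → ℝ≥0∞} (hf : Measurable (Function.uncurry f)) :
    ∫⁻ ω, f (X ω) (Y ω) ∂μ = ∫⁻ ω, ∫⁻ ω', f (X ω') (Y ω) ∂μ ∂μ := by
  have := Measure.isProbabilityMeasure_map (μ := μ) hX.aemeasurable
  have := Measure.isProbabilityMeasure_map (μ := μ) hY.aemeasurable
  calc ∫⁻ ω, f (X ω) (Y ω) ∂μ
      = ∫⁻ z, Function.uncurry f z ∂(μ.map fun ω => (X ω, Y ω)) :=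
        (lintegral_map hf (hX.prodMk hY)).symm
    _ = ∫⁻ y, ∫⁻ x, f x y ∂(μ.map X) ∂(μ.map Y) := by
        rw [h.map_prod_eq_prod_map_map hX.aemeasurable hY.aemeasurable,
          lintegral_prod_symm' _ hf]
        rfl
    _ = ∫⁻ ω, ∫⁻ x, f x (Y ω) ∂(μ.map X) ∂μ :=
        lintegral_map hf.lintegral_prod_left' hY
    _ = _ := lintegral_congr fun ω => lintegral_map (hf.comp measurable_prodMk_right) hX

/-- The Laplace transform of a series of independent nonnegative random variables. -/
theorem lintegral_expNeg_tsum {Ω : Type*} [MeasurableSpace Ω] {μ : Measure Ω}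
    [IsProbabilityMeasure μ] {T : ℕ → Ω → ℝ≥0∞} (hT : iIndepFun T μ) (hTm : ∀ k, Measurable (T k))
    {c : ℕ → ℝ≥0∞} (hc : ∀ k, ∫⁻ ω, expNeg (T k ω) ∂μ = expNeg (c k)) :
    ∫⁻ ω, expNeg (∑' k, T k ω) ∂μ = expNeg (∑' k, c k) := by
  have h1 (n : ℕ) : ∫⁻ ω, ∏ k ∈ Finset.range n, expNeg (T k ω) ∂μ =
      ∏ k ∈ Finset.range n, expNeg (c k) := by
    rw [lintegral_prod_eq_prod_lintegral_of_indepFun (Finset.range n)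
      (fun k ω => expNeg (T k ω)) (hT.comp _ fun _ => measurable_expNeg)
      fun k => measurable_expNeg.comp (hTm k)]
    exact Finset.prod_congr rfl fun k _ => hc k
  have h2 : Filter.Tendsto (fun n => ∫⁻ ω, ∏ k ∈ Finset.range n, expNeg (T k ω) ∂μ) Filter.atTop
      (nhds (∫⁻ ω, expNeg (∑' k, T k ω) ∂μ)) := by
    refine tendsto_lintegral_of_dominated_convergence (fun _ => 1)
      (fun n => Finset.measurable_prod _ fun k _ => measurable_expNeg.comp (hTm k))
      (fun n => .of_forall fun ω => Finset.prod_le_one' fun k _ => expNeg_le_one _) (by simp)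
      (.of_forall fun ω => tendsto_expNeg_tsum _)
  simp_rw [h1] at h2
  exact tendsto_nhds_unique h2 (tendsto_expNeg_tsum c)

section Exponential

theorem lintegral_expMeasure_one {f : ℝ → ℝ≥0∞} (hf : Measurable f) :
    ∫⁻ u, f u ∂(expMeasure 1) =
      ∫⁻ u in Set.Ioi (0 : ℝ), ENNReal.ofReal (Real.exp (-u)) * f u := by
  have h : expMeasure 1 = volume.withDensity (exponentialPDF 1) := rfl
  have hm : Measurable (exponentialPDF 1) := (measurable_exponentialPDFReal 1).ennreal_ofReal
  rw [h, lintegral_withDensity_eq_lintegral_mul _ hm hf, ← setLIntegral_univ,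
    ← Set.Iic_union_Ioi (a := (0 : ℝ)), lintegral_union measurableSet_Ioi
      (Set.Iic_disjoint_Ioi le_rfl), ← setLIntegral_congr Iio_ae_eq_Iic]
  have h1 : ∫⁻ u in Set.Iio (0 : ℝ), (exponentialPDF 1 * f) u = 0 := by
    rw [setLIntegral_congr_fun measurableSet_Iio (g := fun _ => 0), lintegral_zero]
    intro u hu
    simp [exponentialPDF_of_neg hu]
  rw [h1, zero_add]
  refine setLIntegral_congr_fun measurableSet_Ioi fun u hu => ?_
  simp [exponentialPDF_of_nonneg (le_of_lt hu)]

theorem lintegral_exp_neg_mul_Ioi {b : ℝ} (hb : 0 < b) (x : ℝ) :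
    ∫⁻ u in Set.Ioi x, ENNReal.ofReal (Real.exp (-(b * u))) =
      ENNReal.ofReal (Real.exp (-(b * x)) / b) := by
  have h1 := integral_exp_mul_Ioi (a := -b) (by linarith) x
  have h2 := integrableOn_exp_mul_Ioi (a := -b) (by linarith) x
  simp_rw [← neg_mul]
  rw [← ofReal_integral_eq_lintegral_ofReal h2 (.of_forall fun u => (Real.exp_pos _).le), h1]
  congr 1
  field_simp

/-- The Laplace transform of the standard exponential law. -/
theorem lintegral_expNeg_mul_expMeasure (y : ℝ) :
    ∫⁻ u, expNeg (ENNReal.ofReal (y * u)) ∂(expMeasure 1) =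
      expNeg (ENNReal.ofReal (Real.log (1 + max y 0))) := by
  have hy : 0 ≤ max y 0 := le_max_right _ _
  have hm : Measurable fun u : ℝ => expNeg (ENNReal.ofReal (y * u)) :=
    measurable_expNeg.comp (by fun_prop)
  rw [lintegral_expMeasure_one hm, expNeg_ofReal (Real.log_nonneg (by linarith)), Real.exp_neg,
    Real.exp_log (by linarith), setLIntegral_congr_fun measurableSet_Ioi
      (g := fun u => ENNReal.ofReal (Real.exp (-((1 + max y 0) * u)))),
    lintegral_exp_neg_mul_Ioi (by linarith)]
  · simp
  · intro u hu
    have hu : 0 < u := hu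
    -- Negative `y` is truncated to 0. Allowing every real `y` avoids a pointwise sign condition on
    -- the gains, which are nonnegative only almost surely.
    have : ENNReal.ofReal (y * u) = ENNReal.ofReal (max y 0 * u) := by
      rcases le_total y 0 with h | h
      · rw [max_eq_right h, zero_mul, ENNReal.ofReal_zero,
          ENNReal.ofReal_of_nonpos (mul_nonpos_of_nonpos_of_nonneg h hu.le)]
      · rw [max_eq_left h]
    simp only [this]
    rw [expNeg_ofReal (by positivity), ← ENNReal.ofReal_mul (Real.exp_pos _).le, ← Real.exp_add]
    congr 2
    ring

/-- The tail of the standard exponential law. -/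
theorem expMeasure_one_setOf_le (T : ℝ≥0∞) :
    expMeasure 1 {u | T ≤ ENNReal.ofReal u} = expNeg T := by
  have hm : MeasurableSet {u : ℝ | T ≤ ENNReal.ofReal u} :=
    measurableSet_le measurable_const (by fun_prop)
  rw [← lintegral_indicator_one hm, lintegral_expMeasure_one (measurable_one.indicator hm)]
  rcases eq_or_ne T ∞ with rfl | hT
  · simp [expNeg_top]
  · obtain ⟨t, rfl⟩ : ∃ t : ℝ, T = ENNReal.ofReal t := ⟨T.toReal, (ENNReal.ofReal_toReal hT).symm⟩
    have h0 : ENNReal.ofReal t = ENNReal.ofReal (max t 0) := by simp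
    have ht : 0 ≤ max t 0 := le_max_right _ _
    rw [h0, expNeg_ofReal ht]
    generalize max t 0 = t at *
    -- The endpoint `t` satisfies the inequality, so it is discarded as a null point to make the
    -- indicator vanish on all of the left piece.
    rw [← Set.Ioc_union_Ioi_eq_Ioi ht, lintegral_union measurableSet_Ioi
      (Set.Ioc_disjoint_Ioi le_rfl), ← setLIntegral_congr Ioo_ae_eq_Ioc]
    have h1 : ∫⁻ u in Set.Ioo 0 t, ENNReal.ofReal (Real.exp (-u)) *
        {u : ℝ | ENNReal.ofReal t ≤ ENNReal.ofReal u}.indicator 1 u = 0 := by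
      rw [setLIntegral_congr_fun measurableSet_Ioo (g := fun _ => 0), lintegral_zero]
      intro u hu
      have : ¬ ENNReal.ofReal t ≤ ENNReal.ofReal u := by
        rw [ENNReal.ofReal_le_ofReal_iff hu.1.le]
        exact hu.2.not_ge
      simp [this]
    have h2 : ∫⁻ u in Set.Ioi t, ENNReal.ofReal (Real.exp (-u)) *
        {u : ℝ | ENNReal.ofReal t ≤ ENNReal.ofReal u}.indicator 1 u =
        ∫⁻ u in Set.Ioi t, ENNReal.ofReal (Real.exp (-(1 * u))) := by
      refine setLIntegral_congr_fun measurableSet_Ioi fun u hu => ?_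
      have : ENNReal.ofReal t ≤ ENNReal.ofReal u := ENNReal.ofReal_le_ofReal (le_of_lt hu)
      simp [this]
    rw [h1, h2, lintegral_exp_neg_mul_Ioi one_pos, zero_add, one_mul, div_one]

end Exponential

/-- The integrand is 1 / (1 + y d), the fading average already performed; averaging it over the two
lobes gives the attenuation. -/
theorem lintegral_gainLaw {φ : ℝ} (hφ₀ : 0 ≤ φ) (hφ : φ ≤ 2 * Real.pi) {M : Fin 2 → ℝ}
    (hM : ∀ t, 0 ≤ M t) {y : ℝ} (hy : 0 ≤ y) :
    ∫⁻ d, expNeg (ENNReal.ofReal (Real.log (1 + max (y * d) 0))) ∂(gainLaw φ M) =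
      ENNReal.ofReal (attenuation φ M y) := by
  have hm : Measurable fun d : ℝ => expNeg (ENNReal.ofReal (Real.log (1 + max (y * d) 0))) :=
    measurable_expNeg.comp (by fun_prop)
  rw [gainLaw, lintegral_finsetSum_measure, attenuation, ENNReal.ofReal_sum_of_nonneg]
  · refine Finset.sum_congr rfl fun t _ => ?_
    have h := mul_nonneg hy (hM t)
    rw [lintegral_smul_measure, lintegral_dirac' _ hm, max_eq_left h,
      expNeg_ofReal (Real.log_nonneg (by linarith)), Real.exp_neg, Real.exp_log (by linarith),
      smul_eq_mul, ← ENNReal.ofReal_mul (lobeProb_nonneg hφ₀ hφ t), div_eq_mul_inv]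
  · intro t _
    have h := mul_nonneg hy (hM t)
    exact div_nonneg (lobeProb_nonneg hφ₀ hφ t) (by linarith)

/-! ### The downlink model: averaging over fading and gains. -/

/-- The downlink model: base stations, fading coefficients and directivity gains. -/
structure IsDownlinkModel {Ω : Type*} [MeasurableSpace Ω] (μ : Measure Ω) (lam φ : ℝ)
    (M : Fin 2 → ℝ) (Φ : Ω → Set Plane) (α : ℕ → Ω → ℂ) (D : ℕ → Ω → ℝ) : Prop where
  stations : IsHomogeneousPPP μ lam Φ
  measurable_fading : ∀ l, Measurable (α l)
  indep_fading : iIndepFun α μ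
  fading_law : ∀ l, μ.map (fun ω => ‖α l ω‖ ^ 2) = expMeasure 1
  measurable_gain : ∀ l, Measurable (D l)
  indep_gain : iIndepFun D μ
  serving_gain : ∀ᵐ ω ∂μ, D 0 ω = M 0
  gain_law : ∀ k, μ.map (D (k + 1)) = gainLaw φ M
  indep : iIndep ![pointSigma Φ, seqSigma α, seqSigma D] μ

/-- The aggregate interference as a function of the distances `r` and gains `d` of all base
stations and of the fading coefficients `v` of the interferers. -/
noncomputable def shotNoise (P β : ℝ) (r : ℕ → ℝ) (v : ℕ → ℂ) (d : ℕ → ℝ) : ℝ≥0∞ :=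
  ∑' k : ℕ, ENNReal.ofReal (P * r (k + 1) ^ (-β) * ‖v k‖ ^ 2 * d (k + 1))

/-- Only the fading sequence is shifted: the serving fading is thereby separated from the
interference, while the serving distance stays available for the threshold. -/
theorem aggInterference_eq_shotNoise (P β : ℝ) (S : Set Plane) (α : ℕ → ℂ) (D : ℕ → ℝ) :
    aggInterference P β S α D =
      shotNoise P β (fun l => nearestDist S l) (fun k => α (k + 1)) D := rfl

theorem measurable_seqSigma {Ω E : Type*} [MeasurableSpace E] (X : ℕ → Ω → E) :
    Measurable[seqSigma X] fun ω l => X l ω :=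
  @measurable_pi_lambda _ _ _ (seqSigma X) _ _ fun l =>
    measurable_iff_comap_le.2 (le_iSup (fun l => MeasurableSpace.comap (X l) inferInstance) l)

/-- Carries the assumed independence of the σ-algebra of counts over to the ranked distances. -/
theorem measurable_nearestDist_pointSigma {Ω : Type*} (Φ : Ω → Set Plane) :
    Measurable[pointSigma Φ] fun ω l => nearestDist (Φ ω) l :=
  @measurable_pi_lambda _ _ _ (pointSigma Φ) _ _ fun l =>
    @measurable_nearestDist _ (pointSigma Φ) Φ (fun B hB =>
      measurable_iff_comap_le.2 (le_iSup₂ (f := fun (B : Set Plane) (_ : MeasurableSet B) =>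
        MeasurableSpace.comap (fun ω => (Φ ω ∩ B).encard) inferInstance) B hB)) l

namespace IsDownlinkModel

variable {Ω : Type*} [MeasurableSpace Ω] {μ : Measure Ω}
  {lam P β σ φ : ℝ} {M : Fin 2 → ℝ} {Φ : Ω → Set Plane} {α : ℕ → Ω → ℂ} {D : ℕ → Ω → ℝ}

theorem measurable_nearestDist (h : IsDownlinkModel μ lam φ M Φ α D) (l : ℕ) :
    Measurable fun ω => nearestDist (Φ ω) l :=
  CellularNetwork.measurable_nearestDist h.stations.measurable_count l

theorem measurable_distances (h : IsDownlinkModel μ lam φ M Φ α D) :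
    Measurable fun ω l => nearestDist (Φ ω) l :=
  measurable_pi_lambda _ h.measurable_nearestDist

theorem sigma_le (h : IsDownlinkModel μ lam φ M Φ α D) (i : Fin 3) :
    ![pointSigma Φ, seqSigma α, seqSigma D] i ≤ ‹MeasurableSpace Ω› := by
  fin_cases i
  · exact iSup₂_le fun B hB => (h.stations.measurable_count B hB).comap_le
  · exact iSup_le fun l => (h.measurable_fading l).comap_le
  · exact iSup_le fun l => (h.measurable_gain l).comap_le

theorem indepFun_fading (h : IsDownlinkModel μ lam φ M Φ α D) :
    IndepFun (fun ω l => α l ω) (fun ω => (fun l => nearestDist (Φ ω) l, fun l => D l ω)) μ := by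
  -- In the triple, index 1 is the fading; indices 0 and 2 are the stations and the gains, grouped
  -- into one independent block.
  have hi := indep_iSup_of_disjoint h.sigma_le h.indep (S := {1}) (T := {0, 2}) (by simp)
  rw [IndepFun_iff_Indep]
  refine indep_of_indep_of_le_left (indep_of_indep_of_le_right hi ?_) ?_
  · rw [iSup_pair, ← measurable_iff_comap_le]
    exact @Measurable.prodMk _ _ _ _ _ (_) _ _
      ((measurable_nearestDist_pointSigma Φ).mono le_sup_left le_rfl)
      ((measurable_seqSigma D).mono le_sup_right le_rfl)
  · rw [iSup_singleton, ← measurable_iff_comap_le]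
    exact measurable_seqSigma α

theorem indepFun_gain (h : IsDownlinkModel μ lam φ M Φ α D) :
    IndepFun (fun ω l => D l ω) (fun ω l => nearestDist (Φ ω) l) μ := by
  have hi := h.indep.indep (i := 2) (j := 0) (by decide)
  rw [IndepFun_iff_Indep]
  exact indep_of_indep_of_le_left (indep_of_indep_of_le_right hi
    (measurable_iff_comap_le.1 (measurable_nearestDist_pointSigma Φ)))
    (measurable_iff_comap_le.1 (measurable_seqSigma D))

theorem indepFun_serving_fading (h : IsDownlinkModel μ lam φ M Φ α D) :
    IndepFun (α 0) (fun ω k => α (k + 1) ω) μ := by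
  have hi := indep_iSup_of_disjoint (fun l => (h.measurable_fading l).comap_le)
    ((iIndepFun_iff_iIndep _ _ _).1 h.indep_fading) (S := {0}) (T := {0}ᶜ)
    (Set.disjoint_compl_right_iff_subset.2 subset_rfl)
  rw [IndepFun_iff_Indep]
  refine indep_of_indep_of_le_left (indep_of_indep_of_le_right hi ?_) (by simp)
  rw [← measurable_iff_comap_le]
  refine @measurable_pi_lambda _ _ _ (_) _ _ fun k => measurable_iff_comap_le.2 ?_
  exact le_iSup₂ (f := fun (l : ℕ) (_ : l ∈ ({0}ᶜ : Set ℕ)) =>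
    MeasurableSpace.comap (α l) inferInstance) (k + 1) (by simp)

theorem lintegral_fading (h : IsDownlinkModel μ lam φ M Φ α D) (l : ℕ) {f : ℝ → ℝ≥0∞}
    (hf : Measurable f) : ∫⁻ ω, f (‖α l ω‖ ^ 2) ∂μ = ∫⁻ u, f u ∂(expMeasure 1) := by
  have hm := h.measurable_fading l
  rw [← h.fading_law l, lintegral_map hf (by fun_prop)]

theorem measurable_aggInterference (h : IsDownlinkModel μ lam φ M Φ α D) :
    Measurable fun ω => aggInterference P β (Φ ω) (fun l => α l ω) (fun l => D l ω) := by
  unfold aggInterference rxPower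
  refine Measurable.tsum fun k => ?_
  have h1 := h.measurable_nearestDist (k + 1)
  have h2 := h.measurable_fading (k + 1)
  have h3 := h.measurable_gain (k + 1)
  fun_prop

/-- Excludes a quotient 0 / 0 in the SINR, where noise and interference may both vanish. -/
theorem ae_serving_fading_pos (h : IsDownlinkModel μ lam φ M Φ α D) :
    ∀ᵐ ω ∂μ, 0 < ‖α 0 ω‖ ^ 2 := by
  have hm := h.measurable_fading 0
  have h0 : ∀ᵐ u ∂(expMeasure 1), 0 < u := by
    have hs : MeasurableSet {u : ℝ | ¬ 0 < u} := 
      (measurableSet_lt measurable_const measurable_id).compl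
    rw [ae_iff, ← lintegral_indicator_one hs, lintegral_expMeasure_one (measurable_one.indicator hs),
      setLIntegral_congr_fun measurableSet_Ioi (g := fun _ => 0), lintegral_zero]
    intro u hu
    have hu : 0 < u := hu
    simp [hu]
  rw [← h.fading_law 0] at h0
  exact ae_of_ae_map (by fun_prop) h0

variable [IsProbabilityMeasure μ]

/-- The sequence `y` stands for powers with frozen distances and gains. Each exponential fading then
contributes 1 / (1 + y), written as e to minus a logarithm so that the product becomes a series. -/
theorem lintegral_expNeg_tsum_fading (h : IsDownlinkModel μ lam φ M Φ α D) (y : ℕ → ℝ) :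
    ∫⁻ ω, expNeg (∑' k, ENNReal.ofReal (y k * ‖α (k + 1) ω‖ ^ 2)) ∂μ =
      expNeg (∑' k, ENNReal.ofReal (Real.log (1 + max (y k) 0))) := by
  refine lintegral_expNeg_tsum (T := fun k ω => ENNReal.ofReal (y k * ‖α (k + 1) ω‖ ^ 2))
    ((h.indep_fading.precomp (g := fun k : ℕ => k + 1) (add_left_injective 1)).comp
      (fun k v => ENNReal.ofReal (y k * ‖v‖ ^ 2)) fun k => by fun_prop) (fun k => ?_) fun k => ?_
  · have := h.measurable_fading (k + 1)
    fun_prop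
  · rw [h.lintegral_fading (k + 1) (f := fun u => expNeg (ENNReal.ofReal (y k * u)))
      (measurable_expNeg.comp (by fun_prop)), lintegral_expNeg_mul_expMeasure]

theorem lintegral_expNeg_tsum_gain (h : IsDownlinkModel μ lam φ M Φ α D) (hP : 0 < P)
    (hφ₀ : 0 ≤ φ) (hφ : φ ≤ 2 * Real.pi) (hM : ∀ t, 0 ≤ M t) {s : ℝ} (hs : 0 ≤ s) {r : ℕ → ℝ}
    (hr : ∀ k, 0 ≤ r k) :
    ∫⁻ ω, expNeg (∑' k, ENNReal.ofReal
        (Real.log (1 + max (s * P * r k ^ (-β) * D (k + 1) ω) 0))) ∂μ =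
      expNeg (∑' k, attenuationCost P β φ M s (r k)) := by
  refine lintegral_expNeg_tsum (T := fun k ω => ENNReal.ofReal
      (Real.log (1 + max (s * P * r k ^ (-β) * D (k + 1) ω) 0)))
    ((h.indep_gain.precomp (g := fun k : ℕ => k + 1) (add_left_injective 1)).comp
      (fun k d => ENNReal.ofReal (Real.log (1 + max (s * P * r k ^ (-β) * d) 0)))
      fun k => by fun_prop) (fun k => ?_) fun k => ?_
  · have := h.measurable_gain (k + 1)
    fun_prop
  · have hm : Measurable fun d : ℝ =>
        expNeg (ENNReal.ofReal (Real.log (1 + max (s * P * r k ^ (-β) * d) 0))) :=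
      measurable_expNeg.comp (by fun_prop)
    have hr := hr k
    rw [expNeg_attenuationCost hP hφ₀ hφ hM hs hr,
      ← lintegral_gainLaw hφ₀ hφ hM (y := s * P * r k ^ (-β)) (by positivity), ← h.gain_law k,
      lintegral_map hm (h.measurable_gain _)]

/-- Averaging over the fading, given the base stations and the gains. -/
theorem lintegral_mul_expNeg_shotNoise (h : IsDownlinkModel μ lam φ M Φ α D)
    {s : ℝ} (hs : 0 ≤ s) {g : ℝ → ℝ≥0∞} (hg : Measurable g) :
    ∫⁻ ω, g (nearestDist (Φ ω) 0) * expNeg (ENNReal.ofReal s *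
        shotNoise P β (fun l => nearestDist (Φ ω) l) (fun k => α (k + 1) ω) (fun l => D l ω)) ∂μ =
      ∫⁻ ω, g (nearestDist (Φ ω) 0) * expNeg (∑' k, ENNReal.ofReal (Real.log
        (1 + max (s * P * nearestDist (Φ ω) (k + 1) ^ (-β) * D (k + 1) ω) 0))) ∂μ := by
  have hαm : Measurable fun ω l => α l ω := measurable_pi_lambda _ h.measurable_fading
  have hDm : Measurable fun ω l => D l ω := measurable_pi_lambda _ h.measurable_gain
  have hRm := h.measurable_distances
  have hm : Measurable fun z : (ℕ → ℂ) × (ℕ → ℝ) × (ℕ → ℝ) =>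
      shotNoise P β z.2.1 (fun k => z.1 (k + 1)) z.2.2 := by
    unfold shotNoise
    exact Measurable.tsum fun k => by fun_prop
  have key := h.indepFun_fading.lintegral_eq_lintegral_lintegral hαm (hRm.prodMk hDm)
    (f := fun v z => g (z.1 0) * expNeg (ENNReal.ofReal s *
      shotNoise P β z.1 (fun k => v (k + 1)) z.2))
    ((hg.comp (by fun_prop)).mul (measurable_expNeg.comp (hm.const_mul _)))
  refine key.trans (lintegral_congr fun ω => ?_)
  have hy : ∀ ω', ENNReal.ofReal s * shotNoise P β (fun l => nearestDist (Φ ω) l)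
      (fun k => α (k + 1) ω') (fun l => D l ω) = ∑' k, ENNReal.ofReal
        (s * P * nearestDist (Φ ω) (k + 1) ^ (-β) * D (k + 1) ω * ‖α (k + 1) ω'‖ ^ 2) := by
    intro ω'
    rw [shotNoise, ← ENNReal.tsum_mul_left]
    refine tsum_congr fun k => ?_
    rw [← ENNReal.ofReal_mul hs]
    congr 1
    ring
  simp only [hy]
  rw [lintegral_const_mul, h.lintegral_expNeg_tsum_fading]
  refine measurable_expNeg.comp (Measurable.tsum fun k => ?_)
  have := h.measurable_fading (k + 1)
  fun_prop

/-- Averaging over the fading and the gains, given the base stations. -/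
theorem lintegral_mul_expNeg_aggInterference (h : IsDownlinkModel μ lam φ M Φ α D)
    (hlam : 0 < lam) (hP : 0 < P)
    (hφ₀ : 0 ≤ φ) (hφ : φ ≤ 2 * Real.pi) (hM : ∀ t, 0 ≤ M t) {s : ℝ} (hs : 0 ≤ s)
    {g : ℝ → ℝ≥0∞} (hg : Measurable g) :
    ∫⁻ ω, g (nearestDist (Φ ω) 0) * expNeg (ENNReal.ofReal s *
        aggInterference P β (Φ ω) (fun l => α l ω) (fun l => D l ω)) ∂μ =
      ∫⁻ ω, g (nearestDist (Φ ω) 0) *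
        expNeg (∑' l, attenuationCost P β φ M s (nearestDist (Φ ω) (l + 1))) ∂μ := by
  have hDm : Measurable fun ω l => D l ω := measurable_pi_lambda _ h.measurable_gain
  have hm : Measurable fun z : (ℕ → ℝ) × (ℕ → ℝ) => ∑' k, ENNReal.ofReal (Real.log
      (1 + max (s * P * z.2 (k + 1) ^ (-β) * z.1 (k + 1)) 0)) :=
    Measurable.tsum fun k => by fun_prop
  have key := h.indepFun_gain.lintegral_eq_lintegral_lintegral hDm h.measurable_distances
    (f := fun d r => g (r 0) * expNeg (∑' k, ENNReal.ofReal (Real.log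
      (1 + max (s * P * r (k + 1) ^ (-β) * d (k + 1)) 0))))
    ((hg.comp (by fun_prop)).mul (measurable_expNeg.comp hm))
  simp only [aggInterference_eq_shotNoise]
  refine ((h.lintegral_mul_expNeg_shotNoise hs hg).trans key).trans (lintegral_congr_ae ?_)
  filter_upwards [h.stations.ae_isRegularConfig hlam] with ω hω
  rw [lintegral_const_mul]
  · rw [h.lintegral_expNeg_tsum_gain hP hφ₀ hφ hM hs
      (r := fun k => nearestDist (Φ ω) (k + 1)) fun k => (hω.nearestDist_pos _).le]
  · refine measurable_expNeg.comp (Measurable.tsum fun k => ?_)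
    have := h.measurable_gain (k + 1)
    fun_prop

/-- The conditional Laplace transform of the aggregate interference, given the nearest distance,
in integrated form. -/
theorem lintegral_mul_expNeg_const (h : IsDownlinkModel μ lam φ M Φ α D) (hlam : 0 < lam)
    (hP : 0 < P) (hβ : 2 < β) (hφ₀ : 0 ≤ φ) (hφ : φ ≤ 2 * Real.pi) (hM : ∀ t, 0 ≤ M t) {s : ℝ}
    (hs : 0 ≤ s) {g : ℝ → ℝ≥0∞} (hg : Measurable g) :
    ∫⁻ ω, g (nearestDist (Φ ω) 0) * expNeg (ENNReal.ofReal s *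
        aggInterference P β (Φ ω) (fun l => α l ω) (fun l => D l ω)) ∂μ =
      ∫⁻ r in Set.Ioi (0 : ℝ), g r *
        ENNReal.ofReal (nearestPDF lam r * Real.exp (-interferenceExponent lam P β φ M r s)) := by
  rw [h.lintegral_mul_expNeg_aggInterference hlam hP hφ₀ hφ hM hs hg,
    lintegral_mul_expNeg_tsum_succ h.stations hlam hP hβ hφ₀ hφ hM hs hg]

end IsDownlinkModel

/-! ### Closed form through the hypergeometric function. -/

/-- The interference from beyond distance `x` in closed form, for a single gain. -/
theorem integral_Ioi_eq_gaussHypergeometric {β a x : ℝ} (hβ : 2 < β) (ha : 0 ≤ a) (hx : 0 < x) :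
    ∫ r in Set.Ioi x, r * (a * r ^ (-β) / (1 + a * r ^ (-β))) =
      x ^ 2 * (a * x ^ (-β)) / (β - 2) *
        gaussHypergeometric 1 (1 - 2 / β) (2 - 2 / β) (-(a * x ^ (-β))) := by
  have hβ0 : 0 < β := by linarith
  set z : ℝ := a * x ^ (-β) with hz
  have hz0 : 0 ≤ z := by positivity
  set G : ℝ → ℝ := fun r => r * (a * r ^ (-β) / (1 + a * r ^ (-β))) with hG
  have hb : 0 < 1 - 2 / β := by
    rw [sub_pos, div_lt_one hβ0]
    exact hβ
  have h1 : ∫ r in Set.Ioi x, G r = x * ∫ u in Set.Ioi (1 : ℝ), G (x * u) := by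
    rw [integral_comp_mul_left_Ioi G 1 hx, mul_one, smul_eq_mul, mul_inv_cancel_left₀ hx.ne']
  have h2 : ∫ u in Set.Ioi (1 : ℝ), G (x * u) =
      ∫ u in Set.Ioi (0 : ℝ), (Set.Ioi (1 : ℝ)).indicator (fun u => G (x * u)) u := by
    rw [integral_indicator measurableSet_Ioi, Measure.restrict_restrict measurableSet_Ioi,
      Set.inter_eq_left.2 (Set.Ioi_subset_Ioi zero_le_one)]
  have hp : -(1 / β) ≠ 0 := by
    have := one_div_pos.2 hβ0
    linarith
  -- After r = xu, the substitution u = t^(-1/β) maps (0, 1) onto (1, ∞) and makes r^(-β) = x^(-β) t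
  -- linear in t. Here c - b = 1, so the factor (1 - t)^(c - b - 1) of Euler's integral is 1.
  have h3 : ∫ t in Set.Ioi (0 : ℝ), (|(-(1 / β))| * t ^ (-(1 / β) - 1)) •
      (Set.Ioi (1 : ℝ)).indicator (fun u => G (x * u)) (t ^ (-(1 / β))) =
      ∫ t in Set.Ioi (0 : ℝ), (Set.Ioo (0 : ℝ) 1).indicator (fun t => x * z / β *
        (t ^ ((1 - 2 / β) - 1) * (1 - t) ^ ((2 - 2 / β) - (1 - 2 / β) - 1) *
          (1 - -z * t) ^ (-1 : ℝ))) t := by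
    refine setIntegral_congr_fun measurableSet_Ioi fun t ht => ?_
    have ht : 0 < t := ht
    by_cases ht1 : t < 1
    · have hu : 1 < t ^ (-(1 / β)) := Real.one_lt_rpow_of_pos_of_lt_one_of_neg ht ht1 (by
        have := one_div_pos.2 hβ0
        linarith)
      have hpow : (x * t ^ (-(1 / β))) ^ (-β) = x ^ (-β) * t := by
        rw [Real.mul_rpow hx.le (by positivity), ← Real.rpow_mul ht.le,
          show -(1 / β) * -β = 1 by field_simp, Real.rpow_one]
      have habs : |(-(1 / β))| = 1 / β := by
        rw [abs_neg, abs_of_pos (one_div_pos.2 hβ0)]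
      have hmul : t ^ (-(1 / β) - 1) * t ^ (-(1 / β)) * t = t ^ ((1 - 2 / β) - 1) := by
        rw [← Real.rpow_add ht]
        nth_rewrite 2 [← Real.rpow_one t]
        rw [← Real.rpow_add ht]
        congr 1
        ring
      have h1t : (1 - t) ^ ((2 - 2 / β) - (1 - 2 / β) - 1) = 1 := by
        rw [show (2 - 2 / β) - (1 - 2 / β) - 1 = 0 by ring, Real.rpow_zero]
      rw [Set.indicator_of_mem (Set.mem_Ioi.2 hu), Set.indicator_of_mem (Set.mem_Ioo.2 ⟨ht, ht1⟩)]
      simp only [hG]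
      rw [hpow, habs, h1t, ← hmul, Real.rpow_neg_one, smul_eq_mul, ← mul_assoc a, ← hz]
      rw [show 1 - -z * t = 1 + z * t by ring]
      field_simp
    · have hu : ¬ 1 < t ^ (-(1 / β)) := by
        rw [not_lt]
        exact Real.rpow_le_one_of_one_le_of_nonpos (not_lt.1 ht1) (by
          have := one_div_pos.2 hβ0
          linarith)
      rw [Set.indicator_of_notMem (mt Set.mem_Ioi.1 hu),
        Set.indicator_of_notMem fun h => ht1 h.2, smul_zero]
  rw [h1, h2, ← integral_comp_rpow_Ioi _ hp, h3, integral_indicator measurableSet_Ioo,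
    Measure.restrict_restrict measurableSet_Ioo,
    Set.inter_eq_left.2 Set.Ioo_subset_Ioi_self, integral_const_mul, gaussHypergeometric,
    show (2 - 2 / β) - (1 - 2 / β) = 1 by ring, Real.Gamma_one, mul_one,
    show 2 - 2 / β = (1 - 2 / β) + 1 by ring, Real.Gamma_add_one hb.ne']
  have hΓ := (Real.Gamma_pos_of_pos hb).ne'
  have hβ2 : β - 2 ≠ 0 := by linarith
  -- The Euler prefactor is Γ(b + 1) / Γ(b) = b = 1 - 2/β = (β - 2)/β, which absorbs the denominator
  -- β - 2.
  have e : x ^ 2 * z / (β - 2) * (1 - 2 / β) = x * (x * z / β) := by field_simp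
  rw [mul_div_assoc (1 - 2 / β), div_self hΓ, mul_one, ← mul_assoc x, ← e, mul_assoc]

/-- The term in 1 - ∑ c_t / (1 + s P M_t r^(-β)) cancels against the terms in 1 / (s P M_t + r^β);
the hypergeometric terms that remain are the tail integral, computed separately for each gain. -/
theorem interferenceLaplace_eq {lam P β φ : ℝ} {M : Fin 2 → ℝ} (hP : 0 < P) (hβ : 2 < β)
    (hφ₀ : 0 ≤ φ) (hφ : φ ≤ 2 * Real.pi) (hM : ∀ t, 0 ≤ M t) {r s : ℝ} (hr : 0 < r)
    (hs : 0 ≤ s) :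
    interferenceLaplace lam P β φ M r s = Real.exp (-interferenceExponent lam P β φ M r s) := by
  set H : Fin 2 → ℝ := fun t =>
    gaussHypergeometric 1 (1 - 2 / β) (2 - 2 / β) (-(s * P * M t * r ^ (-β))) with hH
  have ha (t : Fin 2) : 0 ≤ s * P * M t := mul_nonneg (by positivity) (hM t)
  have hi (t : Fin 2) : IntegrableOn (fun u : ℝ => u * (s * P * M t * u ^ (-β) /
      (1 + s * P * M t * u ^ (-β)))) (Set.Ioi r) := by
    -- Setting both gains equal to `M t` isolates a single lobe, since the lobe probabilities sum to
    -- one.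
    refine (integrableOn_interference_integrand (M := fun _ => M t) hP hβ hφ₀ hφ
      (fun _ => hM t) hs hr.le).congr_fun (fun u hu => ?_) measurableSet_Ioi
    have hu0 : 0 < u := hr.trans hu
    simp only
    rw [one_sub_attenuation (fun _ => hM t) (by positivity), ← Finset.sum_mul, sum_lobeProb,
      one_mul, mul_right_comm _ _ (M t)]
  have hE : interferenceExponent lam P β φ M r s = 2 * Real.pi * lam * ∑ t, lobeProb φ t *
      (r ^ 2 * (s * P * M t * r ^ (-β)) / (β - 2) * H t) := by
    rw [interferenceExponent]
    congr 1
    calc ∫ u in Set.Ioi r, u * (1 - attenuation φ M (s * P * u ^ (-β)))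
        = ∫ u in Set.Ioi r, ∑ t, lobeProb φ t * (u * (s * P * M t * u ^ (-β) /
            (1 + s * P * M t * u ^ (-β)))) := by
          refine setIntegral_congr_fun measurableSet_Ioi fun u hu => ?_
          have hu0 : 0 < u := hr.trans hu
          rw [one_sub_attenuation hM (by positivity), Finset.mul_sum]
          refine Finset.sum_congr rfl fun t _ => ?_
          rw [mul_right_comm _ _ (M t)]
          ring
      _ = _ := by
          rw [integral_finsetSum _ fun t _ => (hi t).const_mul _]
          refine Finset.sum_congr rfl fun t _ => ?_
          rw [integral_const_mul, integral_Ioi_eq_gaussHypergeometric hβ (ha t) hr]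
  have hsum : 1 - ∑ t : Fin 2, lobeProb φ t / (1 + s * P * M t * r ^ (-β)) =
      ∑ t : Fin 2, lobeProb φ t * (s * P * M t / (s * P * M t + r ^ β)) := by
    nth_rewrite 1 [← sum_lobeProb φ]
    rw [← Finset.sum_sub_distrib]
    refine Finset.sum_congr rfl fun t _ => ?_
    have h1 : 0 < r ^ β := by positivity
    have h2 : 0 < s * P * M t + r ^ β := by linarith [ha t]
    rw [Real.rpow_neg hr.le]
    generalize s * P * M t = a at *
    generalize r ^ β = w at *
    rw [show 1 + a * w⁻¹ = (a + w) / w by field_simp; ring]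
    field_simp
    ring
  rw [interferenceLaplace, hE, hsum]
  congr 1
  rw [Finset.mul_sum, Finset.mul_sum, Finset.mul_sum, ← Finset.sum_sub_distrib,
    ← Finset.sum_neg_distrib]
  refine Finset.sum_congr rfl fun t _ => ?_
  rw [show gaussHypergeometric 1 (1 - 2 / β) (2 - 2 / β) (-(s * P * M t * r ^ (-β))) = H t from rfl]
  ring

/-! ### Finiteness of the interference and distance-dependent Laplace arguments. -/

namespace IsDownlinkModel

variable {Ω : Type*} [MeasurableSpace Ω] {μ : Measure Ω}
  {lam P β σ φ : ℝ} {M : Fin 2 → ℝ} {Φ : Ω → Set Plane} {α : ℕ → Ω → ℂ} {D : ℕ → Ω → ℝ}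
  [IsProbabilityMeasure μ]

theorem lintegral_nearestDist_zero (h : IsDownlinkModel μ lam φ M Φ α D) (hlam : 0 < lam)
    {g : ℝ → ℝ≥0∞} (hg : Measurable g) :
    ∫⁻ ω, g (nearestDist (Φ ω) 0) ∂μ =
      ∫⁻ r in Set.Ioi (0 : ℝ), g r * ENNReal.ofReal (nearestPDF lam r) := by
  have hm : Measurable fun r => ENNReal.ofReal (nearestPDF lam r) := by
    unfold nearestPDF
    fun_prop
  rw [← lintegral_map hg (h.measurable_nearestDist 0), map_nearestDist_zero h.stations hlam,
    lintegral_withDensity_eq_lintegral_mul _ hm hg]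
  simp only [Pi.mul_apply, mul_comm]

theorem lintegral_Ioi_nearestPDF (h : IsDownlinkModel μ lam φ M Φ α D) (hlam : 0 < lam) :
    ∫⁻ r in Set.Ioi (0 : ℝ), ENNReal.ofReal (nearestPDF lam r) = 1 := by
  have := h.lintegral_nearestDist_zero hlam (g := fun _ => 1) measurable_const
  simpa using this.symm

/-- An argument taking countably many values splits the distances into countably many pieces, on
each of which the identity for a fixed argument applies. -/
theorem lintegral_mul_expNeg_step (h : IsDownlinkModel μ lam φ M Φ α D) (hlam : 0 < lam)
    (hP : 0 < P) (hβ : 2 < β) (hφ₀ : 0 ≤ φ) (hφ : φ ≤ 2 * Real.pi) (hM : ∀ t, 0 ≤ M t)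
    {N : ℝ → ℕ} (hN : Measurable N) {q : ℕ → ℝ} (hq : ∀ k, 0 ≤ q k)
    {g : ℝ → ℝ≥0∞} (hg : Measurable g) :
    ∫⁻ ω, g (nearestDist (Φ ω) 0) * expNeg (ENNReal.ofReal (q (N (nearestDist (Φ ω) 0))) *
        aggInterference P β (Φ ω) (fun l => α l ω) (fun l => D l ω)) ∂μ =
      ∫⁻ r in Set.Ioi (0 : ℝ), g r * ENNReal.ofReal
        (nearestPDF lam r * Real.exp (-interferenceExponent lam P β φ M r (q (N r)))) := by
  set gk : ℕ → ℝ → ℝ≥0∞ := fun k => (N ⁻¹' {k}).indicator g with hgk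
  have hgkm (k : ℕ) : Measurable (gk k) := hg.indicator (hN (measurableSet_singleton k))
  have hsplit (r : ℝ) (f : ℕ → ℝ≥0∞) : g r * f (N r) = ∑' k, gk k r * f k := by
    rw [tsum_eq_single (N r)]
    · simp [hgk]
    · intro k hk
      simp [hgk, hk.symm]
  have hIm := h.measurable_aggInterference (P := P) (β := β)
  have hE (k : ℕ) : Measurable fun r => ENNReal.ofReal
      (nearestPDF lam r * Real.exp (-interferenceExponent lam P β φ M r (q k))) := by
    have h1 : Measurable fun r => interferenceExponent lam P β φ M r (q k) :=
      (measurable_interferenceExponent lam P β φ M).comp (measurable_id.prodMk measurable_const)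
    unfold nearestPDF
    fun_prop
  have hl (ω : Ω) := hsplit (nearestDist (Φ ω) 0) fun k => expNeg (ENNReal.ofReal (q k) *
        aggInterference P β (Φ ω) (fun l => α l ω) (fun l => D l ω))
  have hr (r : ℝ) := hsplit r fun k => ENNReal.ofReal
        (nearestPDF lam r * Real.exp (-interferenceExponent lam P β φ M r (q k)))
  simp only [hl, hr]
  have hlm (k : ℕ) : Measurable fun ω => gk k (nearestDist (Φ ω) 0) *
      expNeg (ENNReal.ofReal (q k) *
        aggInterference P β (Φ ω) (fun l => α l ω) (fun l => D l ω)) :=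
    ((hgkm k).comp (h.measurable_nearestDist 0)).mul (measurable_expNeg.comp (hIm.const_mul _))
  have hrm (k : ℕ) : Measurable fun r => gk k r * ENNReal.ofReal
      (nearestPDF lam r * Real.exp (-interferenceExponent lam P β φ M r (q k))) :=
    (hgkm k).mul (hE k)
  rw [lintegral_tsum fun k => (hlm k).aemeasurable,
    lintegral_tsum fun k => (hrm k).aemeasurable]
  exact tsum_congr fun k => h.lintegral_mul_expNeg_const hlam hP hβ hφ₀ hφ hM (hq k) (hgkm k)

/-- As `s` decreases to 0, E e^(-sI) tends to P(I < ∞), while the integral formula tends to the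
total mass 1 of the density of R₁. -/
theorem ae_aggInterference_ne_top (h : IsDownlinkModel μ lam φ M Φ α D) (hlam : 0 < lam)
    (hP : 0 < P) (hβ : 2 < β) (hφ₀ : 0 ≤ φ) (hφ : φ ≤ 2 * Real.pi) (hM : ∀ t, 0 ≤ M t) :
    ∀ᵐ ω ∂μ, aggInterference P β (Φ ω) (fun l => α l ω) (fun l => D l ω) ≠ ∞ := by
  set I : Ω → ℝ≥0∞ := fun ω => aggInterference P β (Φ ω) (fun l => α l ω) (fun l => D l ω) with hI
  have hIm : Measurable I := h.measurable_aggInterference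
  set s : ℕ → ℝ := fun n => 1 / ((n : ℝ) + 1) with hs
  have hs0 (n : ℕ) : 0 < s n := by positivity
  have hslim : Filter.Tendsto s Filter.atTop (nhds 0) := tendsto_one_div_add_atTop_nhds_zero_nat
  have hset : MeasurableSet {ω | I ω ≠ ∞} := hIm (measurableSet_singleton ∞).compl
  have h1 : Filter.Tendsto (fun n => ∫⁻ ω, expNeg (ENNReal.ofReal (s n) * I ω) ∂μ) Filter.atTop
      (nhds (∫⁻ ω, {ω | I ω ≠ ∞}.indicator 1 ω ∂μ)) := by
    refine tendsto_lintegral_of_dominated_convergence (fun _ => 1)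
      (fun n => measurable_expNeg.comp (hIm.const_mul _))
      (fun n => .of_forall fun ω => expNeg_le_one _) (by simp) (.of_forall fun ω => ?_)
    by_cases hω : I ω = ∞
    · have (n : ℕ) : expNeg (ENNReal.ofReal (s n) * I ω) = 0 := by
        rw [hω, ENNReal.mul_top (by simpa using hs0 n), expNeg_top]
      simp only [this]
      rw [Set.indicator_of_notMem (by simpa using hω)]
      exact tendsto_const_nhds
    · rw [Set.indicator_of_mem (show ω ∈ {ω | I ω ≠ ∞} from hω), Pi.one_apply, ← expNeg_zero]
      refine (continuous_expNeg.tendsto _).comp ?_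
      have := ENNReal.Tendsto.mul_const (b := I ω)
        (ENNReal.tendsto_ofReal hslim) (Or.inr hω)
      simpa using this
  have h2 : Filter.Tendsto (fun n => ∫⁻ r in Set.Ioi (0 : ℝ), ENNReal.ofReal
      (nearestPDF lam r * Real.exp (-interferenceExponent lam P β φ M r (s n)))) Filter.atTop
      (nhds (∫⁻ r in Set.Ioi (0 : ℝ), ENNReal.ofReal (nearestPDF lam r))) := by
    refine tendsto_lintegral_of_dominated_convergence
      (fun r => ENNReal.ofReal (nearestPDF lam r)) (fun n => ?_) (fun n => ?_) ?_ ?_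
    · have h1 : Measurable fun r => interferenceExponent lam P β φ M r (s n) :=
        (measurable_interferenceExponent lam P β φ M).comp (measurable_id.prodMk measurable_const)
      unfold nearestPDF
      fun_prop
    · refine (ae_restrict_iff' measurableSet_Ioi).2 (.of_forall fun r hr => ?_)
      have hr0 : 0 < r := hr
      have hE := interferenceExponent_nonneg (β := β) hlam hP hφ₀ hφ hM (hs0 n).le hr0.le
      refine ENNReal.ofReal_le_ofReal (mul_le_of_le_one_right ?_ ?_)
      · unfold nearestPDF
        positivity
      · exact Real.exp_le_one_iff.2 (by linarith)
    · rw [h.lintegral_Ioi_nearestPDF hlam]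
      simp
    · refine (ae_restrict_iff' measurableSet_Ioi).2 (.of_forall fun r hr => ?_)
      refine ENNReal.tendsto_ofReal ?_
      have hc : Filter.Tendsto (fun n => interferenceExponent lam P β φ M r (s n)) Filter.atTop
          (nhds 0) := by
        have := continuousWithinAt_interferenceExponent (lam := lam) (x := r) hP hβ hφ₀ hφ hM
          le_rfl (le_of_lt hr)
        rw [ContinuousWithinAt, interferenceExponent_zero] at this
        exact this.comp (tendsto_nhdsWithin_iff.2 ⟨hslim, .of_forall fun n => (hs0 n).le⟩)
      have := (Real.continuous_exp.tendsto _).comp hc.neg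
      simpa using this.const_mul (nearestPDF lam r)
  have h3 (n : ℕ) : ∫⁻ ω, expNeg (ENNReal.ofReal (s n) * I ω) ∂μ =
      ∫⁻ r in Set.Ioi (0 : ℝ), ENNReal.ofReal
        (nearestPDF lam r * Real.exp (-interferenceExponent lam P β φ M r (s n))) := by
    have := h.lintegral_mul_expNeg_const hlam hP hβ hφ₀ hφ hM (hs0 n).le (g := fun _ => 1)
      measurable_const
    simpa using this
  simp_rw [h3] at h1
  have h4 := tendsto_nhds_unique h1 h2
  rw [lintegral_indicator_one hset, h.lintegral_Ioi_nearestPDF hlam] at h4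
  exact (prob_compl_eq_zero_iff hset).2 h4

/-- The Laplace transform of the aggregate interference at a function of the nearest distance. -/
theorem lintegral_mul_expNeg (h : IsDownlinkModel μ lam φ M Φ α D) (hlam : 0 < lam)
    (hP : 0 < P) (hβ : 2 < β) (hφ₀ : 0 ≤ φ) (hφ : φ ≤ 2 * Real.pi) (hM : ∀ t, 0 ≤ M t)
    {c : ℝ → ℝ} (hc : Measurable c) (hc0 : ∀ r, 0 ≤ c r)
    {g : ℝ → ℝ≥0∞} (hg : Measurable g) (hg1 : ∀ r, g r ≤ 1) :
    ∫⁻ ω, g (nearestDist (Φ ω) 0) * expNeg (ENNReal.ofReal (c (nearestDist (Φ ω) 0)) *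
        aggInterference P β (Φ ω) (fun l => α l ω) (fun l => D l ω)) ∂μ =
      ∫⁻ r in Set.Ioi (0 : ℝ), g r * ENNReal.ofReal
        (nearestPDF lam r * Real.exp (-interferenceExponent lam P β φ M r (c r))) := by
  set I : Ω → ℝ≥0∞ := fun ω => aggInterference P β (Φ ω) (fun l => α l ω) (fun l => D l ω) with hI
  have hIm : Measurable I := h.measurable_aggInterference
  have hRm := h.measurable_nearestDist 0
  -- Rounding `c` down to multiples of 1/n makes it countably valued; at `n = 0` the quotient is 0,
  -- which is harmless in the limit.
  set N : ℕ → ℝ → ℕ := fun n r => ⌊c r * n⌋₊ with hN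
  have hNm (n : ℕ) : Measurable (N n) := Nat.measurable_floor.comp (hc.mul_const _)
  set cn : ℕ → ℝ → ℝ := fun n r => (N n r : ℝ) / n with hcn
  have hcnm (n : ℕ) : Measurable (cn n) :=
    ((measurable_of_countable fun k : ℕ => (k : ℝ)).comp (hNm n)).div_const _
  have hcn0 (n : ℕ) (r : ℝ) : 0 ≤ cn n r := by positivity
  have hcnlim (r : ℝ) : Filter.Tendsto (fun n => cn n r) Filter.atTop (nhds (c r)) :=
    (tendsto_nat_floor_mul_div_atTop (hc0 r)).comp tendsto_natCast_atTop_atTop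
  have h1 : Filter.Tendsto (fun n => ∫⁻ ω, g (nearestDist (Φ ω) 0) *
      expNeg (ENNReal.ofReal (cn n (nearestDist (Φ ω) 0)) * I ω) ∂μ) Filter.atTop
      (nhds (∫⁻ ω, g (nearestDist (Φ ω) 0) *
        expNeg (ENNReal.ofReal (c (nearestDist (Φ ω) 0)) * I ω) ∂μ)) := by
    refine tendsto_lintegral_of_dominated_convergence (fun _ => 1)
      (fun n => (hg.comp hRm).mul (measurable_expNeg.comp
        (((hcnm n).comp hRm).ennreal_ofReal.mul hIm)))
      (fun n => .of_forall fun ω => mul_le_one' (hg1 _) (expNeg_le_one _)) (by simp) ?_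
    -- Finiteness is essential: multiplication by ∞ is not continuous at 0, and `c` may vanish.
    filter_upwards [h.ae_aggInterference_ne_top hlam hP hβ hφ₀ hφ hM] with ω hω
    refine ENNReal.Tendsto.const_mul ((continuous_expNeg.tendsto _).comp ?_)
      (Or.inr ((hg1 _).trans_lt (by simp)).ne)
    exact ENNReal.Tendsto.mul_const (ENNReal.tendsto_ofReal (hcnlim _)) (Or.inr hω)
  have h2 : Filter.Tendsto (fun n => ∫⁻ r in Set.Ioi (0 : ℝ), g r * ENNReal.ofReal
      (nearestPDF lam r * Real.exp (-interferenceExponent lam P β φ M r (cn n r)))) Filter.atTop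
      (nhds (∫⁻ r in Set.Ioi (0 : ℝ), g r * ENNReal.ofReal
        (nearestPDF lam r * Real.exp (-interferenceExponent lam P β φ M r (c r))))) := by
    refine tendsto_lintegral_of_dominated_convergence
      (fun r => ENNReal.ofReal (nearestPDF lam r)) (fun n => ?_) (fun n => ?_) ?_ ?_
    · have h1 : Measurable fun r => interferenceExponent lam P β φ M r (cn n r) :=
        (measurable_interferenceExponent lam P β φ M).comp (measurable_id.prodMk (hcnm n))
      unfold nearestPDF
      fun_prop
    · refine (ae_restrict_iff' measurableSet_Ioi).2 (.of_forall fun r hr => ?_)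
      have hr0 : 0 < r := hr
      have hE := interferenceExponent_nonneg (β := β) hlam hP hφ₀ hφ hM (hcn0 n r) hr0.le
      refine (mul_le_of_le_one_left zero_le (hg1 r)).trans
        (ENNReal.ofReal_le_ofReal (mul_le_of_le_one_right ?_ ?_))
      · unfold nearestPDF
        positivity
      · exact Real.exp_le_one_iff.2 (by linarith)
    · rw [h.lintegral_Ioi_nearestPDF hlam]
      simp
    · refine (ae_restrict_iff' measurableSet_Ioi).2 (.of_forall fun r hr => ?_)
      refine ENNReal.Tendsto.const_mul (ENNReal.tendsto_ofReal (Filter.Tendsto.const_mul _ ?_))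
        (Or.inr ((hg1 _).trans_lt (by simp)).ne)
      refine (Real.continuous_exp.tendsto _).comp (Filter.Tendsto.neg ?_)
      exact (continuousWithinAt_interferenceExponent (lam := lam) (x := r) hP hβ hφ₀ hφ hM
          (hc0 r) (le_of_lt hr)).tendsto.comp
        (tendsto_nhdsWithin_iff.2 ⟨hcnlim r, .of_forall fun n => hcn0 n r⟩)
  refine tendsto_nhds_unique h1 (h2.congr fun n => ?_)
  exact (h.lintegral_mul_expNeg_step hlam hP hβ hφ₀ hφ hM (hNm n)
    (q := fun k => (k : ℝ) / n) (fun k => by positivity) hg).symm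

/-- The serving fading power exceeds a functional of everything else with exponential
probability. -/
theorem measure_le_serving_fading (h : IsDownlinkModel μ lam φ M Φ α D)
    {T : (ℕ → ℂ) → (ℕ → ℝ) × (ℕ → ℝ) → ℝ≥0∞} (hT : Measurable (Function.uncurry T)) :
    μ {ω | T (fun k => α (k + 1) ω) (fun l => nearestDist (Φ ω) l, fun l => D l ω) ≤
        ENNReal.ofReal (‖α 0 ω‖ ^ 2)} =
      ∫⁻ ω, expNeg (T (fun k => α (k + 1) ω)
        (fun l => nearestDist (Φ ω) l, fun l => D l ω)) ∂μ := by
  have hαm : Measurable fun ω l => α l ω := measurable_pi_lambda _ h.measurable_fading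
  have hαm' : Measurable fun ω k => α (k + 1) ω :=
    measurable_pi_lambda _ fun k => h.measurable_fading (k + 1)
  have hDm : Measurable fun ω l => D l ω := measurable_pi_lambda _ h.measurable_gain
  have hZm := h.measurable_distances.prodMk hDm
  have hT' : Measurable fun z : (ℕ → ℂ) × ((ℕ → ℝ) × (ℕ → ℝ)) => T (fun k => z.1 (k + 1)) z.2 :=
    hT.comp (g := Function.uncurry T)
      (by fun_prop : Measurable fun z : (ℕ → ℂ) × ((ℕ → ℝ) × (ℕ → ℝ)) =>
        ((fun k => z.1 (k + 1)), z.2))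
  have hset : MeasurableSet {ω | T (fun k => α (k + 1) ω)
      (fun l => nearestDist (Φ ω) l, fun l => D l ω) ≤ ENNReal.ofReal (‖α 0 ω‖ ^ 2)} := by
    refine measurableSet_le (hT.comp (hαm'.prodMk hZm)) ?_
    have := h.measurable_fading 0
    fun_prop
  have key1 := h.indepFun_fading.lintegral_eq_lintegral_lintegral hαm hZm
    (f := fun v z => if T (fun k => v (k + 1)) z ≤ ENNReal.ofReal (‖v 0‖ ^ 2) then 1 else 0)
    (Measurable.ite (measurableSet_le hT' (by fun_prop)) measurable_const measurable_const)
  have key2 := h.indepFun_fading.lintegral_eq_lintegral_lintegral hαm hZm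
    (f := fun v z => expNeg (T (fun k => v (k + 1)) z)) (measurable_expNeg.comp hT')
  rw [← lintegral_indicator_one hset]
  refine Eq.trans ?_ ((key1.trans (lintegral_congr fun ω => ?_)).trans key2.symm)
  · refine lintegral_congr fun ω => ?_
    simp only [Set.indicator_apply, Set.mem_ofPred_eq, Pi.one_apply]
  generalize ((fun l => nearestDist (Φ ω) l, fun l => D l ω) : (ℕ → ℝ) × (ℕ → ℝ)) = z
  have hTz : Measurable fun v => T v z := hT.comp measurable_prodMk_right
  -- With distances and gains frozen, the interfering fadings are frozen as well; only the serving
  -- fading is then averaged, and the exponential tail applies to a constant threshold.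
  have key3 := h.indepFun_serving_fading.lintegral_eq_lintegral_lintegral
    (h.measurable_fading 0) hαm'
    (f := fun a v => if T v z ≤ ENNReal.ofReal (‖a‖ ^ 2) then 1 else 0)
    (Measurable.ite (measurableSet_le (hTz.comp measurable_snd) (by fun_prop)) measurable_const
      measurable_const)
  refine key3.trans (lintegral_congr fun ω' => ?_)
  generalize T (fun k => α (k + 1) ω') z = τ
  have hτ : MeasurableSet {u : ℝ | τ ≤ ENNReal.ofReal u} :=
    measurableSet_le measurable_const (by fun_prop)
  rw [← expMeasure_one_setOf_le, ← lintegral_indicator_one hτ,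
    ← h.lintegral_fading 0 (measurable_one.indicator hτ)]
  refine lintegral_congr fun ω => ?_
  simp only [Set.indicator_apply, Set.mem_ofPred_eq, Pi.one_apply]

end IsDownlinkModel

/-! ### Conditional Laplace transform and coverage probability. -/

theorem expNeg_ofReal_mul {s : ℝ} (hs : 0 ≤ s) {x : ℝ≥0∞} (hx : x ≠ ∞) :
    expNeg (ENNReal.ofReal s * x) = ENNReal.ofReal (Real.exp (-(s * x.toReal))) := by
  rw [expNeg_eq_ofReal (ENNReal.mul_ne_top ENNReal.ofReal_ne_top hx), ENNReal.toReal_mul,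
    ENNReal.toReal_ofReal hs]

theorem measurable_shotNoise (P β : ℝ) :
    Measurable fun z : (ℕ → ℂ) × (ℕ → ℝ) × (ℕ → ℝ) => shotNoise P β z.2.1 z.1 z.2.2 := by
  unfold shotNoise
  exact Measurable.tsum fun k => by fun_prop

/-- The threshold of the serving fading power, in units of noise plus interference. -/
noncomputable def fadingThreshold (P β ε m r : ℝ) : ℝ := max (ε / (P * r ^ (-β) * m)) 0

theorem measurable_fadingThreshold (P β ε m : ℝ) : Measurable (fadingThreshold P β ε m) := by
  unfold fadingThreshold
  fun_prop

/-- The truncation at 0 secures the sign for every real `r`, as the averaging lemma demands,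
although only positive distances matter. -/
theorem fadingThreshold_nonneg (P β ε m r : ℝ) : 0 ≤ fadingThreshold P β ε m r :=
  le_max_right _ _

theorem fadingThreshold_of_pos {P β ε m r : ℝ} (hP : 0 < P) (hε : 0 ≤ ε) (hm : 0 < m)
    (hr : 0 < r) : fadingThreshold P β ε m r = ε / (P * r ^ (-β) * m) :=
  max_eq_left (by positivity)

namespace IsDownlinkModel

variable {Ω : Type*} [MeasurableSpace Ω] {μ : Measure Ω}
  {lam P β σ φ : ℝ} {M : Fin 2 → ℝ} {Φ : Ω → Set Plane} {α : ℕ → Ω → ℂ} {D : ℕ → Ω → ℝ}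
  [IsProbabilityMeasure μ]

theorem ae_nearestDist_pos (h : IsDownlinkModel μ lam φ M Φ α D) (hlam : 0 < lam) :
    ∀ᵐ ω ∂μ, 0 < nearestDist (Φ ω) 0 := by
  filter_upwards [h.stations.ae_isRegularConfig hlam] with ω hω using hω.nearestDist_pos 0

/-- The conditional Laplace transform of the aggregate interference, given the nearest distance. -/
theorem condExp_exp_neg_aggInterference (h : IsDownlinkModel μ lam φ M Φ α D) (hlam : 0 < lam)
    (hP : 0 < P) (hβ : 2 < β) (hφ₀ : 0 ≤ φ) (hφ : φ ≤ 2 * Real.pi) (hM : ∀ t, 0 ≤ M t) {s : ℝ}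
    (hs : 0 ≤ s) :
    μ[fun ω => Real.exp (-(s * (aggInterference P β (Φ ω)
          (fun l => α l ω) (fun l => D l ω)).toReal)) |
        MeasurableSpace.comap (fun ω => nearestDist (Φ ω) 0) inferInstance]
      =ᵐ[μ] fun ω => interferenceLaplace lam P β φ M (nearestDist (Φ ω) 0) s := by
  set I : Ω → ℝ≥0∞ := fun ω => aggInterference P β (Φ ω) (fun l => α l ω) (fun l => D l ω) with hI
  have hIm : Measurable I := h.measurable_aggInterference
  have hRm := h.measurable_nearestDist 0
  have hpos := h.ae_nearestDist_pos hlam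
  have hexpm : Measurable fun r => Real.exp (-interferenceExponent lam P β φ M r s) :=
    ((measurable_interferenceExponent lam P β φ M).comp
      (measurable_id.prodMk measurable_const)).neg.exp
  have hfm : Measurable fun ω => Real.exp (-(s * (I ω).toReal)) := by fun_prop
  have hfint : Integrable (fun ω => Real.exp (-(s * (I ω).toReal))) μ := by
    refine Integrable.mono' (integrable_const (1 : ℝ)) hfm.aestronglyMeasurable
      (.of_forall fun ω => ?_)
    rw [Real.norm_of_nonneg (Real.exp_pos _).le, Real.exp_le_one_iff]
    have : 0 ≤ s * (I ω).toReal := by positivity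
    linarith
  have hgint : Integrable (fun ω =>
      Real.exp (-interferenceExponent lam P β φ M (nearestDist (Φ ω) 0) s)) μ := by
    refine Integrable.mono' (integrable_const (1 : ℝ)) (hexpm.comp hRm).aestronglyMeasurable ?_
    filter_upwards [hpos] with ω hω
    rw [Real.norm_of_nonneg (Real.exp_pos _).le, Real.exp_le_one_iff]
    have := interferenceExponent_nonneg (β := β) hlam hP hφ₀ hφ hM hs hω.le
    linarith
  have hmain : (fun ω => Real.exp (-interferenceExponent lam P β φ M (nearestDist (Φ ω) 0) s))
      =ᵐ[μ] μ[fun ω => Real.exp (-(s * (I ω).toReal)) |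
        MeasurableSpace.comap (fun ω => nearestDist (Φ ω) 0) inferInstance] := by
    -- Sets of the conditioning σ-algebra are {R₁ ∈ B}, and on them the required equality is the
    -- integrated identity with the indicator of `B` as test function.
    refine ae_eq_condExp_of_forall_setIntegral_eq hRm.comap_le hfint
      (fun _ _ _ => hgint.integrableOn) ?_ ?_
    · rintro _ ⟨B, hB, rfl⟩ -
      have hB' := hRm hB
      rw [integral_eq_lintegral_of_nonneg_ae (.of_forall fun ω => (Real.exp_pos _).le)
          (hexpm.comp hRm).aestronglyMeasurable,
        integral_eq_lintegral_of_nonneg_ae (.of_forall fun ω => (Real.exp_pos _).le)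
          hfm.aestronglyMeasurable]
      congr 1
      have hBm : Measurable (B.indicator (1 : ℝ → ℝ≥0∞)) := measurable_one.indicator hB
      have e1 := h.lintegral_nearestDist_zero hlam (hBm.mul hexpm.ennreal_ofReal)
      have e2 := h.lintegral_mul_expNeg_const hlam hP hβ hφ₀ hφ hM hs hBm
      have e3 : ∫⁻ r in Set.Ioi (0 : ℝ), ((B.indicator 1 : ℝ → ℝ≥0∞) *
            fun r => ENNReal.ofReal (Real.exp (-interferenceExponent lam P β φ M r s))) r *
            ENNReal.ofReal (nearestPDF lam r) =
          ∫⁻ r in Set.Ioi (0 : ℝ), B.indicator 1 r * ENNReal.ofReal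
            (nearestPDF lam r * Real.exp (-interferenceExponent lam P β φ M r s)) := by
        refine lintegral_congr fun r => ?_
        rw [Pi.mul_apply, mul_assoc, ← ENNReal.ofReal_mul (Real.exp_pos _).le,
          mul_comm (Real.exp _)]
      rw [← lintegral_indicator hB', ← lintegral_indicator hB']
      refine Eq.trans ?_ ((e1.trans (e3.trans e2.symm)).trans ?_)
      · refine lintegral_congr fun ω => ?_
        by_cases hω : nearestDist (Φ ω) 0 ∈ B <;> simp [hω]
      · refine lintegral_congr_ae ?_
        filter_upwards [h.ae_aggInterference_ne_top hlam hP hβ hφ₀ hφ hM] with ω hω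
        rw [expNeg_ofReal_mul hs hω]
        by_cases hω : nearestDist (Φ ω) 0 ∈ B <;> simp [hω, hI]
    · exact (hexpm.comp (comap_measurable _)).aestronglyMeasurable
  refine hmain.symm.trans ?_
  filter_upwards [hpos] with ω hω
  rw [interferenceLaplace_eq hP hβ hφ₀ hφ hM hω hs]

/-- Clearing denominators is legitimate where the interference is finite and the serving power
positive. The result compares the serving fading with a functional independent of it. -/
theorem ae_le_sinr_iff (h : IsDownlinkModel μ lam φ M Φ α D) (hlam : 0 < lam)
    (hP : 0 < P) (hβ : 2 < β) (hφ₀ : 0 ≤ φ) (hφ : φ ≤ 2 * Real.pi) (hM : ∀ t, 0 ≤ M t)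
    (hM₀ : 0 < M 0) {ε : ℝ} (hε : 0 ≤ ε) :
    ∀ᵐ ω ∂μ, ENNReal.ofReal ε ≤ sinr P β σ (Φ ω) (fun l => α l ω) (fun l => D l ω) ↔
      ENNReal.ofReal (fadingThreshold P β ε (M 0) (nearestDist (Φ ω) 0)) *
        (aggInterference P β (Φ ω) (fun l => α l ω) (fun l => D l ω) + ENNReal.ofReal (σ ^ 2)) ≤
        ENNReal.ofReal (‖α 0 ω‖ ^ 2) := by
  filter_upwards [h.ae_nearestDist_pos hlam, h.ae_serving_fading_pos, h.serving_gain,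
    h.ae_aggInterference_ne_top hlam hP hβ hφ₀ hφ hM] with ω hR hα hD hI
  set R := nearestDist (Φ ω) 0 with hRdef
  set J := aggInterference P β (Φ ω) (fun l => α l ω) (fun l => D l ω) + ENNReal.ofReal (σ ^ 2)
    with hJ
  have hJ' : J ≠ ∞ := ENNReal.add_ne_top.2 ⟨hI, ENNReal.ofReal_ne_top⟩
  set w : ℝ := P * R ^ (-β) * M 0 with hw
  have hw0 : 0 < w := by positivity
  have hrx : rxPower P β (Φ ω) (fun l => α l ω) (fun l => D l ω) 0 =
      ENNReal.ofReal w * ENNReal.ofReal (‖α 0 ω‖ ^ 2) := by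
    rw [rxPower, hD, ← ENNReal.ofReal_mul hw0.le]
    congr 1
    rw [hw, hRdef]
    ring
  have hwne : ENNReal.ofReal w ≠ 0 := by simpa using hw0
  have hεw : ENNReal.ofReal ε = ENNReal.ofReal w * ENNReal.ofReal (ε / w) := by
    rw [← ENNReal.ofReal_mul hw0.le, mul_div_cancel₀ _ hw0.ne']
  have hrx0 : ENNReal.ofReal w * ENNReal.ofReal (‖α 0 ω‖ ^ 2) ≠ 0 :=
    mul_ne_zero hwne (ENNReal.ofReal_pos.2 hα).ne'
  rw [fadingThreshold_of_pos hP hε hM₀ hR, sinr, hrx, ← hw, ← hJ,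
    ENNReal.le_div_iff_mul_le (Or.inr hrx0) (Or.inl hJ'), hεw, mul_assoc,
    ENNReal.mul_le_mul_iff_right hwne ENNReal.ofReal_ne_top]

/-- The exponential tail turns the probability into E e^(-c(R₁)(I + σ²)). The noise factor depends
on R₁ alone and serves as test function for the Laplace transform at c(R₁). -/
theorem measure_le_sinr (h : IsDownlinkModel μ lam φ M Φ α D) (hlam : 0 < lam)
    (hP : 0 < P) (hβ : 2 < β) (hφ₀ : 0 ≤ φ) (hφ : φ ≤ 2 * Real.pi) (hM : ∀ t, 0 ≤ M t)
    (hM₀ : 0 < M 0) {ε : ℝ} (hε : 0 ≤ ε) :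
    μ {ω | ENNReal.ofReal ε ≤ sinr P β σ (Φ ω) (fun l => α l ω) (fun l => D l ω)} =
      ∫⁻ r in Set.Ioi (0 : ℝ), ENNReal.ofReal (Real.exp (-(ε * σ ^ 2 / (P * r ^ (-β) * M 0))) *
          interferenceLaplace lam P β φ M r (ε / (P * r ^ (-β) * M 0)) * nearestPDF lam r) := by
  set c := fadingThreshold P β ε (M 0) with hc
  have hcm : Measurable c := measurable_fadingThreshold P β ε (M 0)
  set T : (ℕ → ℂ) → (ℕ → ℝ) × (ℕ → ℝ) → ℝ≥0∞ := fun v z =>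
    ENNReal.ofReal (c (z.1 0)) * (shotNoise P β z.1 v z.2 + ENNReal.ofReal (σ ^ 2)) with hT
  have hTm : Measurable (Function.uncurry T) := by
    refine Measurable.mul ?_ ((measurable_shotNoise P β).add measurable_const)
    exact (hcm.comp (by fun_prop)).ennreal_ofReal
  set g : ℝ → ℝ≥0∞ := fun r => expNeg (ENNReal.ofReal (c r) * ENNReal.ofReal (σ ^ 2)) with hg
  have hgm : Measurable g := measurable_expNeg.comp (hcm.ennreal_ofReal.mul_const _)
  calc μ {ω | ENNReal.ofReal ε ≤ sinr P β σ (Φ ω) (fun l => α l ω) (fun l => D l ω)}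
      = μ {ω | T (fun k => α (k + 1) ω) (fun l => nearestDist (Φ ω) l, fun l => D l ω) ≤
          ENNReal.ofReal (‖α 0 ω‖ ^ 2)} := by
        refine measure_congr ?_
        filter_upwards [h.ae_le_sinr_iff (σ := σ) hlam hP hβ hφ₀ hφ hM hM₀ hε] with ω hω
        exact propext hω
    _ = ∫⁻ ω, expNeg (T (fun k => α (k + 1) ω)
          (fun l => nearestDist (Φ ω) l, fun l => D l ω)) ∂μ := h.measure_le_serving_fading hTm
    _ = ∫⁻ ω, g (nearestDist (Φ ω) 0) * expNeg (ENNReal.ofReal (c (nearestDist (Φ ω) 0)) *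
          aggInterference P β (Φ ω) (fun l => α l ω) (fun l => D l ω)) ∂μ := by
        refine lintegral_congr fun ω => ?_
        simp only [hT, hg]
        rw [mul_add, add_comm, expNeg_add, aggInterference_eq_shotNoise]
    _ = ∫⁻ r in Set.Ioi (0 : ℝ), g r * ENNReal.ofReal
          (nearestPDF lam r * Real.exp (-interferenceExponent lam P β φ M r (c r))) :=
        h.lintegral_mul_expNeg hlam hP hβ hφ₀ hφ hM hcm (fadingThreshold_nonneg P β ε (M 0)) hgm
          fun r => expNeg_le_one _
    _ = _ := by
        refine setLIntegral_congr_fun measurableSet_Ioi fun r hr => ?_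
        have hr0 : 0 < r := hr
        have hs : 0 ≤ ε / (P * r ^ (-β) * M 0) := by positivity
        simp only [hg, hc]
        rw [fadingThreshold_of_pos hP hε hM₀ hr0, interferenceLaplace_eq hP hβ hφ₀ hφ hM hr0 hs,
          expNeg_ofReal_mul hs ENNReal.ofReal_ne_top, ENNReal.toReal_ofReal (sq_nonneg σ),
          ← ENNReal.ofReal_mul (Real.exp_pos _).le, div_mul_eq_mul_div, mul_comm (nearestPDF lam r),
          ← mul_assoc (Real.exp _)]

/-- The coverage probability. -/
theorem coverage (h : IsDownlinkModel μ lam φ M Φ α D) (hlam : 0 < lam)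
    (hP : 0 < P) (hβ : 2 < β) (hφ₀ : 0 ≤ φ) (hφ : φ ≤ 2 * Real.pi) (hM : ∀ t, 0 ≤ M t)
    (hM₀ : 0 < M 0) {ε : ℝ} (hε : 0 ≤ ε) :
    IntegrableOn (fun r : ℝ => Real.exp (-(ε * σ ^ 2 / (P * r ^ (-β) * M 0))) *
        interferenceLaplace lam P β φ M r (ε / (P * r ^ (-β) * M 0)) *
        nearestPDF lam r) (Set.Ioi 0) ∧
    μ.real {ω | ENNReal.ofReal ε ≤ sinr P β σ (Φ ω) (fun l => α l ω) (fun l => D l ω)} =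
      ∫ r in Set.Ioi (0 : ℝ), Real.exp (-(ε * σ ^ 2 / (P * r ^ (-β) * M 0))) *
        interferenceLaplace lam P β φ M r (ε / (P * r ^ (-β) * M 0)) *
        nearestPDF lam r := by
  set f : ℝ → ℝ := fun r => Real.exp (-(ε * σ ^ 2 / (P * r ^ (-β) * M 0))) *
        interferenceLaplace lam P β φ M r (ε / (P * r ^ (-β) * M 0)) * nearestPDF lam r with hf
  have hlin := h.measure_le_sinr (σ := σ) hlam hP hβ hφ₀ hφ hM hM₀ hε
  have hnn : 0 ≤ᵐ[volume.restrict (Set.Ioi 0)] f := by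
    refine (ae_restrict_iff' measurableSet_Ioi).2 (.of_forall fun r hr => ?_)
    have hr0 : 0 < r := hr
    simp only [hf, Pi.zero_apply, interferenceLaplace, nearestPDF]
    positivity
  -- Measurability is read off the integral form of the exponent, which agrees with the closed form
  -- on positive distances.
  have hmeas : AEStronglyMeasurable f (volume.restrict (Set.Ioi 0)) := by
    have hm : Measurable fun r : ℝ => Real.exp (-(ε * σ ^ 2 / (P * r ^ (-β) * M 0))) *
        Real.exp (-interferenceExponent lam P β φ M r (ε / (P * r ^ (-β) * M 0))) *
        nearestPDF lam r := by
      have h1 : Measurable fun r =>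
          interferenceExponent lam P β φ M r (ε / (P * r ^ (-β) * M 0)) :=
        (measurable_interferenceExponent lam P β φ M).comp (measurable_id.prodMk (by fun_prop))
      unfold nearestPDF
      fun_prop
    refine hm.aestronglyMeasurable.congr ?_
    refine (ae_restrict_iff' measurableSet_Ioi).2 (.of_forall fun r hr => ?_)
    have hr0 : 0 < r := hr
    simp only [hf]
    rw [interferenceLaplace_eq hP hβ hφ₀ hφ hM hr0 (by positivity)]
  refine ⟨⟨hmeas, ?_⟩, ?_⟩
  -- The integrand is nonnegative and its integral is a probability, hence finite.
  · rw [hasFiniteIntegral_iff_ofReal hnn, ← hlin]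
    exact measure_lt_top _ _
  · rw [integral_eq_lintegral_of_nonneg_ae hnn hmeas, ← hlin]
    rfl

end IsDownlinkModel

end CellularNetwork

theorem theorem2 {Ω : Type*} [MeasurableSpace Ω] (μ : Measure Ω) [IsProbabilityMeasure μ]
    (lam P β σ φ : ℝ) (M : Fin 2 → ℝ)
    (hlam : 0 < lam) (hP : 0 < P) (hβ : 2 < β)
    (hφ₀ : 0 ≤ φ) (hφ : φ ≤ 2 * Real.pi) (hM₀ : 0 < M 0) (hM₁ : 0 ≤ M 1)
    (Φ : Ω → Set CellularNetwork.Plane) (α : ℕ → Ω → ℂ) (D : ℕ → Ω → ℝ)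
    -- the base stations
    (hΦ : CellularNetwork.IsHomogeneousPPP μ lam Φ)
    -- independent Rayleigh fading: the fading powers are standard exponential
    (hα : ∀ l, Measurable (α l)) (hα_indep : iIndepFun α μ)
    (hα_law : ∀ l, μ.map (fun ω => ‖α l ω‖ ^ 2) = expMeasure 1)
    -- the serving beam is aligned with the user, the interfering gains are independent
    (hD : ∀ l, Measurable (D l)) (hD_indep : iIndepFun D μ)
    (hD_serving : ∀ᵐ ω ∂μ, D 0 ω = M 0)
    (hD_law : ∀ k, μ.map (D (k + 1)) = CellularNetwork.gainLaw φ M)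
    -- base stations, fading and gains are independent
    (hindep : iIndep ![CellularNetwork.pointSigma Φ, CellularNetwork.seqSigma α,
      CellularNetwork.seqSigma D] μ) :
    -- the distance to the nearest base station has density `f_{R₁}`
    (Measurable (fun ω => CellularNetwork.nearestDist (Φ ω) 0) ∧
      μ.map (fun ω => CellularNetwork.nearestDist (Φ ω) 0) =
        (volume.restrict (Set.Ioi 0)).withDensity
          (fun r => ENNReal.ofReal (CellularNetwork.nearestPDF lam r))) ∧
    -- the Laplace transform of the aggregate interference, given the nearest distance
    ((∀ᵐ ω ∂μ, CellularNetwork.aggInterference P β (Φ ω) (fun l => α l ω) (fun l => D l ω) ≠ ∞) ∧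
      ∀ s : ℝ, 0 ≤ s →
        μ[fun ω => Real.exp (-(s * (CellularNetwork.aggInterference P β (Φ ω)
              (fun l => α l ω) (fun l => D l ω)).toReal)) |
            MeasurableSpace.comap (fun ω => CellularNetwork.nearestDist (Φ ω) 0) inferInstance]
          =ᵐ[μ] fun ω => CellularNetwork.interferenceLaplace lam P β φ M
            (CellularNetwork.nearestDist (Φ ω) 0) s) ∧
    -- the coverage probability
    ∀ ε : ℝ, 0 ≤ ε →
      IntegrableOn (fun r : ℝ => Real.exp (-(ε * σ ^ 2 / (P * r ^ (-β) * M 0))) *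
          CellularNetwork.interferenceLaplace lam P β φ M r (ε / (P * r ^ (-β) * M 0)) *
          CellularNetwork.nearestPDF lam r) (Set.Ioi 0) ∧
      μ.real {ω | ENNReal.ofReal ε ≤
          CellularNetwork.sinr P β σ (Φ ω) (fun l => α l ω) (fun l => D l ω)} =
        ∫ r in Set.Ioi (0 : ℝ), Real.exp (-(ε * σ ^ 2 / (P * r ^ (-β) * M 0))) *
          CellularNetwork.interferenceLaplace lam P β φ M r (ε / (P * r ^ (-β) * M 0)) *
          CellularNetwork.nearestPDF lam r := by
  have h : CellularNetwork.IsDownlinkModel μ lam φ M Φ α D :=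
    ⟨hΦ, hα, hα_indep, hα_law, hD, hD_indep, hD_serving, hD_law, hindep⟩
  have hM : ∀ t, 0 ≤ M t := by
    intro t
    fin_cases t
    exacts [hM₀.le, hM₁]
  exact ⟨⟨h.measurable_nearestDist 0, CellularNetwork.map_nearestDist_zero hΦ hlam⟩,
    ⟨h.ae_aggInterference_ne_top hlam hP hβ hφ₀ hφ hM,
      fun s hs => h.condExp_exp_neg_aggInterference hlam hP hβ hφ₀ hφ hM hs⟩,
    fun ε hε => h.coverage hlam hP hβ hφ₀ hφ hM hM₀ hε⟩
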